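/- Let $\mathbb{K}$ be a field of characteristic zero. A permutation $\sigma$ of size $|\sigma| = n \ge 0$ is written as a word $\sigma_1\cdots\sigma_n$ on the letters $1,\dots,n$; let $\mathfrak{S}$ be the set of permutations of all sizes. For a word $w$ on the positive integers, $\operatorname{std}(w)$ is the permutation $\pi$ of size $|w|$ such that, for all $i<j$, $\pi_i<\pi_j$ iff $w_i\le w_j$. Let $\mathbf{FQSym}$ be the Hopf algebra over $\mathbb{K}$ with basis $\{\mathbf{F}_\sigma\}_{\sigma\in\mathfrak{S}}$, product $$\mathbf{F}_\sigma\cdot\mathbf{F}_\nu=\sum_{\pi}\mathbf{F}_\pi ,$$ where $\pi$ runs over all shuffles of the words $\sigma_1\cdots\sigma_{|\sigma|}$ and $(\nu_1+|\sigma|)\cdots(\nu_{|\nu|}+|\sigma|)$, and coproduct $$\Delta(\mathbf{F}_\sigma)=\sum_{0\le i\le|\sigma|}\mathbf{F}_{\operatorname{std}(\sigma_1\cdots\sigma_i)}\otimes\mathbf{F}_{\operatorname{std}(\sigma_{i+1}\cdots\sigma_{|\sigma|})};$$ its unit is $\mathbf{F}_\epsilon$, where $\epsilon$ is the empty permutation,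 and its counit sends $\mathbf{F}_\epsilon$ to $1$ and every other $\mathbf{F}_\sigma$ to $0$. The canopy of a binary tree is the word on $\{0,1\}$ obtained by reading its leaves from left to right, except the first and the last one, and writing $0$ for a leaf that is a right child and $1$ for a leaf that is a left child. A pair of twin binary trees is a pair $(T_L,T_R)$ of (unlabeled) binary trees with the same number of nodes whose canopies differ at every position; let $\mathcal{TBT}$ be the set of these pairs. For a permutation $\sigma$, start from the pair of empty labeled binary trees and read the letters $a=\sigma_1,\sigma_2,\dots$ of $\sigma$ from left to right. Each letter $a$ is inserted into the first tree as a new leaf node: at a node labeled $b$ one goes to the left subtree if $a<b$ and to the right subtree otherwise, until an empty tree is reached, which is replaced by a single node labeled $a$. The second tree $T$ is replaced by the tree with root $a$, left subtree $T_{\le a}$ and right subtree $T_{>a}$, where $T_{\le a}$ (resp. $T_{>a}$) is the binary search tree made of the nodes of $T$ with label $\le a$ (resp. $>a$) in which ancestors are ancestors in $T$. Let $\mathbb{P}(\sigma)$ be the pair of shapes (the trees without their labels) of the two trees obtained at the end. **Theorem.** The elements $$\mathbf{P}_J:=\sum_{\sigma\in\mathfrak{S},\ \mathbb{P}(\sigma)=J}\mathbf{F}_\sigma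 ,\qquad J\in\mathcal{TBT},$$ span a Hopf subalgebra of $\mathbf{FQSym}$: their linear span $\mathbf{Baxter}$ contains the unit, is closed under the product and the antipode, and satisfies $\Delta(\mathbf{Baxter})\subseteq\mathbf{Baxter}\otimes\mathbf{Baxter}$. -/

import Mathlib

open scoped TensorProduct

namespace BaxterHopf

/-- Permutations of all sizes `n ≥ 0`. -/
abbrev Permutation : Type := Σ n : ℕ, Equiv.Perm (Fin n)

/-- One-line notation `σ₁ ⋯ σₙ`, a word on the letters `1, …, n`. -/
def word (σ : Permutation) : List ℕ := List.ofFn fun i => (σ.2 i : ℕ) + 1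

/-- Standardization: `Tuple.sort` sends a rank to the position of the letter of that rank
(equal letters being ranked from left to right); its inverse sends a position to the rank. -/
def std (w : List ℕ) : Permutation := ⟨w.length, (Tuple.sort w.get)⁻¹⟩

/-- The shuffle product of two words, as the list (with multiplicities) of its terms. -/
def shuffle : List ℕ → List ℕ → List (List ℕ)
  | [], v => [v]
  | a :: u, [] => [a :: u]
  | a :: u, b :: v =>
    (shuffle u (b :: v)).map (List.cons a) ++ (shuffle (a :: u) v).map (List.cons b)
  termination_by u v => u.length + v.length

/-- The shifted shuffle of two permutations. All the words that are shuffled here are already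
permutations, and `std` only turns them into elements of `Permutation`. -/
def shiftedShuffle (σ ν : Permutation) : List Permutation :=
  (shuffle (word σ) ((word ν).map (· + σ.1))).map std

/-! Elementary facts on standardization. -/

theorem std_eq (w : List ℕ) {n : ℕ} (h : w.length = n) (g : Fin n → ℕ)
    (hg : ∀ i, g i = w.get (Fin.cast h.symm i)) : std w = ⟨n, (Tuple.sort g)⁻¹⟩ := by
  subst h
  have : g = w.get := funext hg
  subst this
  rfl

theorem std_word (σ : Permutation) : std (word σ) = σ := by
  obtain ⟨n, s⟩ := σ
  rw [std_eq (word ⟨n, s⟩) (n := n) (by simp [word]) (fun i => (s i : ℕ) + 1)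
    (by intro i; simp [word]; rfl)]
  have : s⁻¹ = Tuple.sort (fun i => (s i : ℕ) + 1) := by
    rw [Tuple.eq_sort_iff]
    constructor
    · intro i j hij
      simpa using hij
    · intro i j hij h
      simp only [Equiv.Perm.coe_inv, Equiv.apply_symm_apply] at h
      have : i = j := Fin.ext (by omega)
      exact absurd this hij.ne
  rw [← this, inv_inv]

theorem std_map (w : List ℕ) (f : ℕ → ℕ) (hf : StrictMonoOn f {x | x ∈ w}) :
    std (w.map f) = std w := by
  rw [std_eq (w.map f) (n := w.length) (by simp) (fun i => f (w.get i)) (by intro i; simp)]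
  have : Tuple.sort w.get = Tuple.sort (fun i => f (w.get i)) := by
    rw [Tuple.eq_sort_iff]
    constructor
    · intro i j hij
      exact (hf.le_iff_le (List.get_mem w _) (List.get_mem w _)).2 (Tuple.monotone_sort w.get hij)
    · intro i j hij h
      exact (Tuple.eq_sort_iff.1 (rfl : Tuple.sort w.get = _)).2 i j hij
        (hf.injOn (List.get_mem w _) (List.get_mem w _) h)
  rw [← this]
  rfl

theorem exists_word_std (w : List ℕ) (hw : w.Nodup) :
    ∃ f : ℕ → ℕ, StrictMonoOn f {x | x ∈ w} ∧ word (std w) = w.map f := by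
  classical
  have key : ∀ i : Fin w.length, w.idxOf (w.get i) = i := fun i => by
    simpa using List.Nodup.idxOf_getElem hw i i.2
  let s := Tuple.sort w.get
  refine ⟨fun x => if h : w.idxOf x < w.length then (s⁻¹ ⟨w.idxOf x, h⟩ : ℕ) + 1 else 0, ?_, ?_⟩
  · intro x hx y hy hxy
    have hx' := List.idxOf_lt_length_of_mem hx
    have hy' := List.idxOf_lt_length_of_mem hy
    simp only [hx', hy', dif_pos]
    by_contra! hcon
    have h1 : s⁻¹ ⟨w.idxOf y, hy'⟩ ≤ s⁻¹ ⟨w.idxOf x, hx'⟩ := by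
      rw [Fin.le_def]; omega
    have h2 := Tuple.monotone_sort w.get h1
    simp only [Function.comp_apply, s, Equiv.Perm.coe_inv, Equiv.apply_symm_apply] at h2
    simp at h2
    omega
  · apply List.ext_get
    · simp [word, std]
    · intro i h1 h2
      have hi : i < w.length := by simpa using h2
      have := key ⟨i, hi⟩
      simp only [List.get_eq_getElem] at this
      simp [word, std, this, s, hi]

theorem word_nodup (σ : Permutation) : (word σ).Nodup := by
  rw [word, List.nodup_ofFn]
  intro i j h
  exact σ.2.injective (Fin.ext (by simpa using h))

theorem mem_word {σ : Permutation} {x : ℕ} (h : x ∈ word σ) : 1 ≤ x ∧ x ≤ σ.1 := by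
  rw [word, List.mem_ofFn] at h
  obtain ⟨i, rfl⟩ := h
  have := (σ.2 i).2
  omega

theorem length_word (σ : Permutation) : (word σ).length = σ.1 := by simp [word]

theorem shuffle_nil_left (v : List ℕ) : shuffle [] v = [v] := by rw [shuffle]

theorem shuffle_nil_right (u : List ℕ) : shuffle u [] = [u] := by cases u <;> rw [shuffle]

theorem shuffle_cons_cons (a b : ℕ) (u v : List ℕ) : shuffle (a :: u) (b :: v) =
    (shuffle u (b :: v)).map (List.cons a) ++ (shuffle (a :: u) v).map (List.cons b) := by
  rw [shuffle]

theorem shuffle_map (f : ℕ → ℕ) (u v : List ℕ) :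
    shuffle (u.map f) (v.map f) = (shuffle u v).map (List.map f) := by
  induction u generalizing v with
  | nil => simp [shuffle_nil_left]
  | cons a u ihu =>
    induction v with
    | nil => simp [shuffle_nil_right]
    | cons b v ihv =>
      have h1 := ihu (b :: v)
      simp only [List.map_cons] at h1 ihv ⊢
      rw [shuffle_cons_cons, shuffle_cons_cons, h1, ihv]
      simp [Function.comp_def]

theorem perm_of_mem_shuffle {u v w : List ℕ} (h : w ∈ shuffle u v) : w.Perm (u ++ v) := by
  induction u generalizing v w with
  | nil => simp [shuffle_nil_left] at h; simp [h]
  | cons a u ihu =>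
    induction v generalizing w with
    | nil => simp [shuffle_nil_right] at h; simp [h]
    | cons b v ihv =>
      rw [shuffle_cons_cons, List.mem_append, List.mem_map, List.mem_map] at h
      rcases h with ⟨x, hx, rfl⟩ | ⟨x, hx, rfl⟩
      · exact (ihu hx).cons a
      · exact ((ihv hx).cons b).trans (List.perm_middle (l₁ := a :: u)).symm

section Sums

variable {M : Type*} [AddCommMonoid M]

/-- Sum of `g` over the shuffles of `u` and `v`. -/
def shuffleSum (g : List ℕ → M) (u v : List ℕ) : M := ((shuffle u v).map g).sum

theorem shuffleSum_nil_left (g : List ℕ → M) (v : List ℕ) : shuffleSum g [] v = g v := by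
  simp [shuffleSum, shuffle_nil_left]

theorem shuffleSum_nil_right (g : List ℕ → M) (u : List ℕ) : shuffleSum g u [] = g u := by
  simp [shuffleSum, shuffle_nil_right]

theorem shuffleSum_cons_cons (g : List ℕ → M) (a b : ℕ) (u v : List ℕ) :
    shuffleSum g (a :: u) (b :: v) =
      shuffleSum (fun x => g (a :: x)) u (b :: v) +
        shuffleSum (fun x => g (b :: x)) (a :: u) v := by
  simp [shuffleSum, shuffle_cons_cons, Function.comp_def]

theorem shuffleSum_add (g h : List ℕ → M) (u v : List ℕ) :
    shuffleSum (fun x => g x + h x) u v = shuffleSum g u v + shuffleSum h u v := by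
  simp [shuffleSum]

theorem shuffleSum_congr {g h : List ℕ → M} {u v : List ℕ}
    (H : ∀ x, x.Perm (u ++ v) → g x = h x) : shuffleSum g u v = shuffleSum h u v := by
  unfold shuffleSum
  congr 1
  exact List.map_congr_left fun x hx => H x (perm_of_mem_shuffle hx)

theorem map_shuffleSum {N : Type*} [AddCommMonoid N] (φ : M →+ N) (g : List ℕ → M)
    (u v : List ℕ) : φ (shuffleSum g u v) = shuffleSum (fun x => φ (g x)) u v := by
  simp [shuffleSum, map_list_sum, Function.comp_def]

theorem shuffleSum_assoc (g : List ℕ → M) (u v w : List ℕ) :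
    shuffleSum (fun x => shuffleSum g x w) u v = shuffleSum (fun y => shuffleSum g u y) v w := by
  induction u generalizing g v w with
  | nil => simp [shuffleSum_nil_left]
  | cons a u ihu =>
    induction v generalizing g w with
    | nil => simp [shuffleSum_nil_left, shuffleSum_nil_right]
    | cons b v ihv =>
      induction w generalizing g with
      | nil => simp [shuffleSum_nil_right]
      | cons c w ihw =>
        have e1 := ihu (fun x => g (a :: x)) (b :: v) (c :: w)
        have e2 := ihv (fun x => g (b :: x)) (c :: w)
        have e3 := ihw (fun x => g (c :: x))
        rw [shuffleSum_cons_cons] at e1 e3 ⊢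
        rw [shuffleSum_cons_cons _ b c]
        simp only [shuffleSum_cons_cons g, shuffleSum_add] at e1 e2 e3 ⊢
        rw [e1, e2, add_add_add_comm, e3]
        abel

/-- Sum of `g u v` over the factorizations `w = u v`. -/
def cutSum (g : List ℕ → List ℕ → M) (w : List ℕ) : M :=
  ∑ i ∈ Finset.range (w.length + 1), g (w.take i) (w.drop i)

theorem cutSum_nil (g : List ℕ → List ℕ → M) : cutSum g [] = g [] [] := by
  simp [cutSum]

theorem cutSum_cons (g : List ℕ → List ℕ → M) (a : ℕ) (w : List ℕ) :
    cutSum g (a :: w) = g [] (a :: w) + cutSum (fun x y => g (a :: x) y) w := by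
  rw [cutSum, List.length_cons, Finset.sum_range_succ', add_comm]
  simp [cutSum]

theorem cutSum_add (g h : List ℕ → List ℕ → M) (w : List ℕ) :
    cutSum (fun x y => g x y + h x y) w = cutSum g w + cutSum h w := by
  simp [cutSum, Finset.sum_add_distrib]

theorem cutSum_congr {g h : List ℕ → List ℕ → M} {w : List ℕ}
    (H : ∀ x y, x ++ y = w → g x y = h x y) : cutSum g w = cutSum h w :=
  Finset.sum_congr rfl fun _ _ => H _ _ (List.take_append_drop _ _)

theorem map_cutSum {N : Type*} [AddCommMonoid N] (φ : M →+ N) (g : List ℕ → List ℕ → M)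
    (w : List ℕ) : φ (cutSum g w) = cutSum (fun x y => φ (g x y)) w := by
  simp [cutSum, map_sum]

theorem cutSum_map (g : List ℕ → List ℕ → M) (f : ℕ → ℕ) (w : List ℕ) :
    cutSum g (w.map f) = cutSum (fun x y => g (x.map f) (y.map f)) w := by
  simp [cutSum, List.map_take, List.map_drop]

theorem cutSum_assoc (g : List ℕ → List ℕ → List ℕ → M) (w : List ℕ) :
    cutSum (fun x y => cutSum (fun p q => g p q y) x) w =
      cutSum (fun x y => cutSum (fun p q => g x p q) y) w := by
  induction w generalizing g with
  | nil => simp [cutSum_nil]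
  | cons a w ih =>
    rw [cutSum_cons, cutSum_cons]
    simp only [cutSum_cons, cutSum_nil, cutSum_add]
    rw [ih (fun p q y => g (a :: p) q y), add_assoc]

theorem cutSum_shuffleSum (g : List ℕ → List ℕ → M) (u v : List ℕ) :
    shuffleSum (fun w => cutSum g w) u v =
      cutSum (fun u₁ u₂ => cutSum (fun v₁ v₂ =>
        shuffleSum (fun x => shuffleSum (fun y => g x y) u₂ v₂) u₁ v₁) v) u := by
  induction u generalizing g v with
  | nil => simp [shuffleSum_nil_left, cutSum_nil]
  | cons a u ihu =>
    induction v generalizing g with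
    | nil => simp [shuffleSum_nil_right, cutSum_nil]
    | cons b v ihv =>
      rw [shuffleSum_cons_cons]
      simp only [cutSum_cons g, shuffleSum_add]
      rw [ihu (fun x y => g (a :: x) y), ihv (fun x y => g (b :: x) y)]
      have e : shuffleSum (fun x => g [] x) (a :: u) (b :: v) =
        shuffleSum (fun x => g [] (a :: x)) u (b :: v) +
          shuffleSum (fun x => g [] (b :: x)) (a :: u) v := shuffleSum_cons_cons _ _ _ _ _
      simp only [cutSum_cons, cutSum_add, shuffleSum_nil_left, shuffleSum_nil_right,
        shuffleSum_cons_cons (fun x => shuffleSum (fun y => g x y) _ _)]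
      rw [e]
      abel

end Sums

/-! ### The Hopf algebra `FQSym` -/

/-- The underlying vector space of `FQSym`: the free module on all permutations. -/
def FQSym (K : Type*) [CommRing K] : Type _ := Permutation →₀ K

namespace FQSym

variable (K : Type*) [CommRing K]

noncomputable instance : AddCommGroup (FQSym K) := inferInstanceAs (AddCommGroup (Permutation →₀ K))

noncomputable instance : Module K (FQSym K) := inferInstanceAs (Module K (Permutation →₀ K))

/-- The fundamental basis `(F_σ)`. -/
noncomputable def F : Module.Basis Permutation K (FQSym K) :=
  Module.Basis.ofRepr (LinearEquiv.refl K (Permutation →₀ K))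

/-- The product: `F_σ · F_ν` is the sum of `F_π` over the `π` in the shifted shuffle of
`σ` and `ν`. -/
noncomputable def product : FQSym K →ₗ[K] FQSym K →ₗ[K] FQSym K :=
  (F K).constr K fun σ => (F K).constr K fun ν => ((shiftedShuffle σ ν).map (F K)).sum

/-- The coproduct: `Δ(F_σ) = ∑_{0 ≤ i ≤ n} F_{std(σ₁⋯σᵢ)} ⊗ F_{std(σᵢ₊₁⋯σₙ)}`. -/
noncomputable def coproduct : FQSym K →ₗ[K] FQSym K ⊗[K] FQSym K :=
  (F K).constr K fun σ => ∑ i ∈ Finset.range (σ.1 + 1),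
    F K (std ((word σ).take i)) ⊗ₜ[K] F K (std ((word σ).drop i))

/-- The counit: the coefficient of `F` at the empty permutation. -/
noncomputable def counitMap : FQSym K →ₗ[K] K :=
  (F K).constr K fun σ => if σ.1 = 0 then 1 else 0

/-- The basis element attached to the standardization of a word. -/
noncomputable def Fw (w : List ℕ) : FQSym K := F K (std w)

theorem F_eq (σ : Permutation) : F K σ = Fw K (word σ) := by rw [Fw, std_word]

theorem Fw_map {w : List ℕ} {f : ℕ → ℕ} (hf : StrictMonoOn f {x | x ∈ w}) :
    Fw K (w.map f) = Fw K w := by rw [Fw, Fw, std_map w f hf]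

theorem product_Fw {u v : List ℕ} (hu : u.Nodup) (hv : v.Nodup)
    (huv : ∀ x ∈ u, ∀ y ∈ v, x < y) :
    product K (Fw K u) (Fw K v) = shuffleSum (Fw K) u v := by
  classical
  obtain ⟨f, hf, hfu⟩ := exists_word_std u hu
  obtain ⟨g, hg, hgv⟩ := exists_word_std v hv
  have hfle : ∀ x ∈ u, f x ≤ (std u).1 := fun x hx =>
    (mem_word (by rw [hfu]; exact List.mem_map_of_mem hx)).2
  have hgle : ∀ x ∈ v, 1 ≤ g x := fun x hx =>
    (mem_word (σ := std v) (by rw [hgv]; exact List.mem_map_of_mem hx)).1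
  let h : ℕ → ℕ := fun x => if x ∈ u then f x else g x + (std u).1
  have hh : StrictMonoOn h {x | x ∈ u ++ v} := by
    intro x hx y hy hxy
    simp only [Set.mem_ofPred_eq, List.mem_append] at hx hy
    by_cases hxu : x ∈ u
    · by_cases hyu : y ∈ u
      · simpa [h, hxu, hyu] using hf hxu hyu hxy
      · have := hfle x hxu
        have := hgle y (hy.resolve_left hyu)
        simp only [h, hxu, hyu, if_true, if_false]
        omega
    · by_cases hyu : y ∈ u
      · have := huv y hyu x (hx.resolve_left hxu)
        omega
      · simpa [h, hxu, hyu] using hg (hx.resolve_left hxu) (hy.resolve_left hyu) hxy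
  have e1 : word (std u) = u.map h := by
    rw [hfu]
    exact List.map_congr_left fun x hx => by simp [h, hx]
  have e2 : (word (std v)).map (· + (std u).1) = v.map h := by
    rw [hgv, List.map_map]
    refine List.map_congr_left fun x hx => ?_
    have : x ∉ u := fun hxu => lt_irrefl _ (huv x hxu x hx)
    simp [h, this]
  rw [Fw, Fw, product, Module.Basis.constr_basis, Module.Basis.constr_basis, shiftedShuffle, e1, e2,
    shuffle_map, List.map_map, List.map_map, shuffleSum]
  congr 1
  refine List.map_congr_left fun w hw => ?_
  exact Fw_map K (w := w) (f := h) (hh.mono fun x hx => (perm_of_mem_shuffle hw).subset hx)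

theorem coproduct_Fw {w : List ℕ} (hw : w.Nodup) :
    coproduct K (Fw K w) = cutSum (fun x y => Fw K x ⊗ₜ[K] Fw K y) w := by
  obtain ⟨f, hf, hfw⟩ := exists_word_std w hw
  have : coproduct K (Fw K w) = cutSum (fun x y => Fw K x ⊗ₜ[K] Fw K y) (w.map f) := by
    rw [Fw, coproduct, Module.Basis.constr_basis, hfw]
    simp [cutSum, Fw, std]
  rw [this, cutSum_map]
  refine cutSum_congr fun x y hxy => ?_
  subst hxy
  rw [Fw_map K (hf.mono fun z hz => List.mem_append_left _ hz),
    Fw_map K (hf.mono fun z hz => List.mem_append_right _ hz)]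

theorem counit_Fw (w : List ℕ) : counitMap K (Fw K w) = if w = [] then 1 else 0 := by
  rw [Fw, counitMap, Module.Basis.constr_basis]
  simp [std]

noncomputable instance : Mul (FQSym K) := ⟨fun x y => product K x y⟩

noncomputable instance : One (FQSym K) := ⟨F K ⟨0, 1⟩⟩

theorem one_eq : (1 : FQSym K) = Fw K [] := by
  change F K _ = F K _
  congr 1
  simp only [std, List.length_nil]
  congr 1
  exact Subsingleton.elim _ _

theorem mul_def (x y : FQSym K) : x * y = product K x y := rfl

theorem Fw_mul {u v : List ℕ} (hu : u.Nodup) (hv : v.Nodup) (huv : ∀ x ∈ u, ∀ y ∈ v, x < y) :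
    Fw K u * Fw K v = shuffleSum (Fw K) u v := product_Fw K hu hv huv

/-- Every basis element comes from a word with distinct letters, all of them larger than a
given bound. -/
theorem F_eq_shift (σ : Permutation) (m : ℕ) : F K σ = Fw K ((word σ).map (· + m)) := by
  rw [Fw_map K, F_eq]
  intro x _ y _ hxy
  simpa using hxy

theorem shift_nodup (σ : Permutation) (m : ℕ) : ((word σ).map (· + m)).Nodup :=
  (word_nodup σ).map (fun _ _ h => by simpa using h)

theorem shift_mem {σ : Permutation} {m x : ℕ} (h : x ∈ (word σ).map (· + m)) :
    m < x ∧ x ≤ m + σ.1 := by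
  obtain ⟨y, hy, rfl⟩ := List.mem_map.1 h
  have := mem_word hy
  omega

theorem F_mul_assoc (σ ν π : Permutation) : F K σ * F K ν * F K π = F K σ * (F K ν * F K π) := by
  have hu := word_nodup σ
  have hu' := fun x (hx : x ∈ word σ) => mem_word hx
  have hv := shift_nodup ν σ.1
  have hv' := fun x => shift_mem (σ := ν) (m := σ.1) (x := x)
  have hw := shift_nodup π (σ.1 + ν.1)
  have hw' := fun x => shift_mem (σ := π) (m := σ.1 + ν.1) (x := x)
  rw [F_eq K σ, F_eq_shift K ν σ.1, F_eq_shift K π (σ.1 + ν.1)]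
  generalize word σ = u at *
  generalize (word ν).map (· + σ.1) = v at *
  generalize (word π).map (· + (σ.1 + ν.1)) = w at *
  have huv : ∀ x ∈ u, ∀ y ∈ v, x < y := fun x hx y hy => by
    have := hu' x hx; have := hv' y hy; omega
  have huw : ∀ x ∈ u, ∀ y ∈ w, x < y := fun x hx y hy => by
    have := hu' x hx; have := hw' y hy; omega
  have hvw : ∀ x ∈ v, ∀ y ∈ w, x < y := fun x hx y hy => by
    have := hv' x hx; have := hw' y hy; omega
  rw [Fw_mul K hu hv huv, Fw_mul K hv hw hvw]
  have l : shuffleSum (Fw K) u v * Fw K w =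
      shuffleSum (fun x => shuffleSum (Fw K) x w) u v := by
    refine (map_shuffleSum ((product K).flip (Fw K w)).toAddMonoidHom _ _ _).trans ?_
    refine shuffleSum_congr fun x hx => ?_
    refine product_Fw K (hx.nodup_iff.2 ?_) hw ?_
    · rw [List.nodup_append]
      exact ⟨hu, hv, fun a ha b hb => (huv a ha b hb).ne⟩
    · intro a ha b hb
      rcases List.mem_append.1 (hx.subset ha) with h | h
      · exact huw a h b hb
      · exact hvw a h b hb
  have r : Fw K u * shuffleSum (Fw K) v w =
      shuffleSum (fun x => shuffleSum (Fw K) u x) v w := by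
    refine (map_shuffleSum (product K (Fw K u)).toAddMonoidHom _ _ _).trans ?_
    refine shuffleSum_congr fun x hx => ?_
    refine product_Fw K hu (hx.nodup_iff.2 ?_) ?_
    · rw [List.nodup_append]
      exact ⟨hv, hw, fun a ha b hb => (hvw a ha b hb).ne⟩
    · intro a ha b hb
      rcases List.mem_append.1 (hx.subset hb) with h | h
      · exact huv a ha b h
      · exact huw a ha b h
  rw [l, r, shuffleSum_assoc]

theorem induction {p : FQSym K → Prop} (x : FQSym K) (zero : p 0)
    (add : ∀ x y, p x → p y → p (x + y)) (smul : ∀ (c : K) x, p x → p (c • x))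
    (basis : ∀ σ, p (F K σ)) : p x := by
  refine Submodule.span_induction (p := fun x _ => p x) ?_ zero (fun x y _ _ => add x y)
    (fun c x _ => smul c x) ((F K).mem_span x)
  rintro _ ⟨σ, rfl⟩
  exact basis σ

theorem product_assoc (x y z : FQSym K) :
    product K (product K x y) z = product K x (product K y z) := by
  induction x using induction K with
  | zero => simp
  | add x x' h h' => simp [h, h']
  | smul c x h => simp [h]
  | basis σ =>
    induction y using induction K with
    | zero => simp
    | add x x' h h' => simp [h, h']
    | smul c x h => simp [h]
    | basis ν =>
      induction z using induction K with
      | zero => simp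
      | add x x' h h' => simp [h, h']
      | smul c x h => simp [h]
      | basis π => exact F_mul_assoc K σ ν π

theorem product_one_left (x : FQSym K) : product K 1 x = x := by
  induction x using induction K with
  | zero => simp
  | add x x' h h' => simp [h, h']
  | smul c x h => simp [h]
  | basis σ =>
    rw [one_eq, F_eq, product_Fw K List.nodup_nil (word_nodup σ) (by simp), shuffleSum_nil_left]

theorem product_one_right (x : FQSym K) : product K x 1 = x := by
  induction x using induction K with
  | zero => simp
  | add x x' h h' => simp [h, h']
  | smul c x h => simp [h]
  | basis σ =>
    rw [one_eq, F_eq, product_Fw K (word_nodup σ) List.nodup_nil (by simp), shuffleSum_nil_right]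

noncomputable instance : Ring (FQSym K) where
  __ := (inferInstance : AddCommGroup (FQSym K))
  __ := (inferInstance : Mul (FQSym K))
  __ := (inferInstance : One (FQSym K))
  left_distrib x y z := (product K x).map_add y z
  right_distrib x y z := by simp [mul_def]
  zero_mul x := by simp [mul_def]
  mul_zero x := by simp [mul_def]
  mul_assoc := product_assoc K
  one_mul := product_one_left K
  mul_one := product_one_right K

noncomputable instance : Algebra K (FQSym K) :=
  Algebra.ofModule (fun c x y => by simp [mul_def]) (fun c x y => by simp [mul_def])

noncomputable instance : CoalgebraStruct K (FQSym K) where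
  comul := coproduct K
  counit := counitMap K

open Coalgebra

theorem comul_Fw {w : List ℕ} (hw : w.Nodup) :
    comul (R := K) (Fw K w) = cutSum (fun x y => Fw K x ⊗ₜ[K] Fw K y) w := coproduct_Fw K hw

theorem counit_F (w : List ℕ) : counit (R := K) (Fw K w) = if w = [] then 1 else 0 :=
  counit_Fw K w

/-- A linear map applied to a coproduct. -/
theorem map_comul_Fw {N : Type*} [AddCommGroup N] [Module K N]
    (φ : FQSym K ⊗[K] FQSym K →ₗ[K] N) {w : List ℕ} (hw : w.Nodup) :
    φ (comul (R := K) (Fw K w)) = cutSum (fun x y => φ (Fw K x ⊗ₜ[K] Fw K y)) w := by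
  rw [comul_Fw K hw]
  exact map_cutSum φ.toAddMonoidHom _ _

theorem cutSum_counit_left {N : Type*} [AddCommMonoid N] (g : List ℕ → List ℕ → N) (w : List ℕ) :
    cutSum (fun x y => if x = [] then g x y else 0) w = g [] w := by
  cases w with
  | nil => simp [cutSum_nil]
  | cons a w => rw [cutSum_cons]; simp [cutSum]

theorem cutSum_counit_right {N : Type*} [AddCommMonoid N] (g : List ℕ → List ℕ → N)
    (w : List ℕ) : cutSum (fun x y => if y = [] then g x y else 0) w = g w [] := by
  induction w generalizing g with
  | nil => simp [cutSum_nil]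
  | cons a w ih => rw [cutSum_cons, ih (fun x y => g (a :: x) y)]; simp

noncomputable instance : Coalgebra K (FQSym K) where
  coassoc := by
    refine (F K).ext fun σ => ?_
    have hw := word_nodup σ
    rw [F_eq]
    generalize word σ = w at *
    have hl : (TensorProduct.assoc K (FQSym K) (FQSym K) (FQSym K))
        ((comul (R := K)).rTensor (FQSym K) (comul (R := K) (Fw K w))) =
        cutSum (fun x y => cutSum (fun p q => Fw K p ⊗ₜ[K] (Fw K q ⊗ₜ[K] Fw K y)) x) w := by
      refine (map_comul_Fw K ((TensorProduct.assoc K (FQSym K) (FQSym K) (FQSym K)).toLinearMap ∘ₗ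
        (comul (R := K)).rTensor (FQSym K)) hw).trans (cutSum_congr fun x y hxy => ?_)
      have hx : x.Nodup := by subst hxy; exact hw.of_append_left
      exact map_comul_Fw K ((TensorProduct.assoc K (FQSym K) (FQSym K) (FQSym K)).toLinearMap ∘ₗ
        (TensorProduct.mk K (FQSym K ⊗[K] FQSym K) (FQSym K)).flip (Fw K y)) hx
    have hr : (comul (R := K)).lTensor (FQSym K) (comul (R := K) (Fw K w)) =
        cutSum (fun x y => cutSum (fun p q => Fw K x ⊗ₜ[K] (Fw K p ⊗ₜ[K] Fw K q)) y) w := by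
      refine (map_comul_Fw K ((comul (R := K)).lTensor (FQSym K)) hw).trans
        (cutSum_congr fun x y hxy => ?_)
      have hy : y.Nodup := by subst hxy; exact hw.of_append_right
      exact map_comul_Fw K (TensorProduct.mk K (FQSym K) (FQSym K ⊗[K] FQSym K) (Fw K x)) hy
    exact hl.trans ((cutSum_assoc _ _).trans hr.symm)
  rTensor_counit_comp_comul := by
    refine (F K).ext fun σ => ?_
    rw [F_eq]
    refine (map_comul_Fw K ((counit (R := K)).rTensor (FQSym K)) (word_nodup σ)).trans ?_
    refine Eq.trans ?_ (cutSum_counit_left (fun _ y => (1 : K) ⊗ₜ[K] Fw K y) (word σ))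
    refine cutSum_congr fun x y _ => ?_
    rw [LinearMap.rTensor_tmul, counit_F]
    split_ifs <;> simp
  lTensor_counit_comp_comul := by
    refine (F K).ext fun σ => ?_
    rw [F_eq]
    refine (map_comul_Fw K ((counit (R := K)).lTensor (FQSym K)) (word_nodup σ)).trans ?_
    refine Eq.trans ?_ (cutSum_counit_right (fun x _ => Fw K x ⊗ₜ[K] (1 : K)) (word σ))
    refine cutSum_congr fun x y _ => ?_
    rw [LinearMap.lTensor_tmul, counit_F]
    split_ifs <;> simp

/-- An element of a product of two basis elements, with its factors realized on disjoint
intervals of letters. -/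
theorem exists_words (σ ν : Permutation) : ∃ u v : List ℕ, u.Nodup ∧ v.Nodup ∧
    (∀ x ∈ u, ∀ y ∈ v, x < y) ∧ F K σ = Fw K u ∧ F K ν = Fw K v :=
  ⟨word σ, (word ν).map (· + σ.1), word_nodup σ, shift_nodup ν σ.1,
    fun x hx y hy => by have := mem_word hx; have := shift_mem hy; omega,
    F_eq K σ, F_eq_shift K ν σ.1⟩

theorem comul_mul_F (σ ν : Permutation) : comul (R := K) (F K σ * F K ν) =
    comul (R := K) (F K σ) * comul (R := K) (F K ν) := by
  obtain ⟨u, v, hu, hv, huv, e₁, e₂⟩ := exists_words K σ ν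
  rw [e₁, e₂, Fw_mul K hu hv huv]
  have l : comul (R := K) (shuffleSum (Fw K) u v) =
      shuffleSum (fun w => cutSum (fun x y => Fw K x ⊗ₜ[K] Fw K y) w) u v := by
    refine (map_shuffleSum (comul (R := K) (A := FQSym K)).toAddMonoidHom _ _ _).trans
      (shuffleSum_congr fun x hx => comul_Fw K (hx.nodup_iff.2 ?_))
    rw [List.nodup_append]
    exact ⟨hu, hv, fun a ha b hb => (huv a ha b hb).ne⟩
  rw [l, cutSum_shuffleSum]
  refine Eq.symm ?_
  refine (map_comul_Fw K (LinearMap.mulRight K (comul (R := K) (Fw K v))) hu).trans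
    (cutSum_congr fun u₁ u₂ h₁ => ?_)
  refine (map_comul_Fw K (LinearMap.mulLeft K (Fw K u₁ ⊗ₜ[K] Fw K u₂)) hv).trans
    (cutSum_congr fun v₁ v₂ h₂ => ?_)
  subst h₁ h₂
  rw [LinearMap.mulLeft_apply, Algebra.TensorProduct.tmul_mul_tmul,
    Fw_mul K hu.of_append_left hv.of_append_left
      (fun x hx y hy => huv x (List.mem_append_left _ hx) y (List.mem_append_left _ hy)),
    Fw_mul K hu.of_append_right hv.of_append_right
      (fun x hx y hy => huv x (List.mem_append_right _ hx) y (List.mem_append_right _ hy))]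
  refine (map_shuffleSum ((TensorProduct.mk K (FQSym K) (FQSym K)).flip
    (shuffleSum (Fw K) u₂ v₂)).toAddMonoidHom _ _ _).trans (shuffleSum_congr fun x _ => ?_)
  exact map_shuffleSum (TensorProduct.mk K (FQSym K) (FQSym K) (Fw K x)).toAddMonoidHom _ _ _

theorem counit_mul_F (σ ν : Permutation) : counit (R := K) (F K σ * F K ν) =
    counit (R := K) (F K σ) * counit (R := K) (F K ν) := by
  obtain ⟨u, v, hu, hv, huv, e₁, e₂⟩ := exists_words K σ ν
  rw [e₁, e₂, Fw_mul K hu hv huv]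
  refine (map_shuffleSum (counit (R := K) (A := FQSym K)).toAddMonoidHom _ _ _).trans ?_
  cases u with
  | nil => 
    rw [shuffleSum_nil_left, counit_F K []]
    simp
  | cons a u =>
    rw [counit_F K (a :: u)]
    have : shuffleSum (fun x => (counit (R := K) (A := FQSym K)).toAddMonoidHom (Fw K x))
        (a :: u) v = shuffleSum (fun _ => (0 : K)) (a :: u) v := by
      refine shuffleSum_congr fun x hx => (counit_F K x).trans (if_neg ?_)
      rintro rfl
      simpa using hx.length_eq
    rw [this]
    simp [shuffleSum]

noncomputable instance : Bialgebra K (FQSym K) where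
  counit_one := by rw [one_eq, counit_F]; simp
  mul_compr₂_counit := (F K).ext fun σ => (F K).ext fun ν => counit_mul_F K σ ν
  comul_one := by
    rw [one_eq, comul_Fw K List.nodup_nil, cutSum_nil, Algebra.TensorProduct.one_def, one_eq]
  mul_compr₂_comul := (F K).ext fun σ => (F K).ext fun ν => comul_mul_F K σ ν

/-- The recursion `S(F_∅) = 1` and `S(F_σ) = -∑_{0 ≤ i < n} S(F_{std(σ₁⋯σᵢ)}) F_{std(σᵢ₊₁⋯σₙ)}`
for the antipode. -/
noncomputable def antipodeWord (w : List ℕ) : FQSym K :=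
  if w = [] then 1 else
    -∑ i : Fin w.length, antipodeWord (w.take i) * Fw K (w.drop i)
  termination_by w.length
  decreasing_by simp

/-- The mirror image of the preceding recursion. -/
noncomputable def antipodeWord' (w : List ℕ) : FQSym K :=
  if w = [] then 1 else
    -∑ i : Fin w.length, Fw K (w.take (i + 1)) * antipodeWord' (w.drop (i + 1))
  termination_by w.length
  decreasing_by
    have := i.2
    simp
    omega

theorem antipodeWord_map (w : List ℕ) (f : ℕ → ℕ) (hf : StrictMonoOn f {x | x ∈ w}) :
    antipodeWord K (w.map f) = antipodeWord K w := by
  induction h : w.length using Nat.strong_induction_on generalizing w with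
  | _ n ih =>
    subst h
    rw [antipodeWord, antipodeWord]
    by_cases hw : w = []
    · simp [hw]
    · rw [if_neg hw, if_neg (by simpa using hw), neg_inj]
      refine Fintype.sum_equiv (finCongr (by simp)) _ _ fun i => ?_
      have hi : (i : ℕ) < w.length := by simpa using i.2
      rw [← List.map_take, ← List.map_drop,
        Fw_map K (hf.mono fun x hx => List.mem_of_mem_drop hx),
        ih _ (by simpa using hi) _ (hf.mono fun x hx => List.mem_of_mem_take hx) rfl]
      rfl

theorem antipodeWord'_map (w : List ℕ) (f : ℕ → ℕ) (hf : StrictMonoOn f {x | x ∈ w}) :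
    antipodeWord' K (w.map f) = antipodeWord' K w := by
  induction h : w.length using Nat.strong_induction_on generalizing w with
  | _ n ih =>
    subst h
    rw [antipodeWord', antipodeWord']
    by_cases hw : w = []
    · simp [hw]
    · rw [if_neg hw, if_neg (by simpa using hw), neg_inj]
      refine Fintype.sum_equiv (finCongr (by simp)) _ _ fun i => ?_
      have hi : (i : ℕ) < w.length := by simpa using i.2
      rw [← List.map_take, ← List.map_drop,
        Fw_map K (hf.mono fun x hx => List.mem_of_mem_take hx),
        ih _ (by simp; omega) _ (hf.mono fun x hx => List.mem_of_mem_drop hx) rfl]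
      rfl

/-- The antipode. -/
noncomputable def antipodeMap : FQSym K →ₗ[K] FQSym K :=
  (F K).constr K fun σ => antipodeWord K (word σ)

/-- The right convolution inverse of the identity, which equals the antipode. -/
noncomputable def antipodeMap' : FQSym K →ₗ[K] FQSym K :=
  (F K).constr K fun σ => antipodeWord' K (word σ)

theorem antipodeMap_Fw {w : List ℕ} (hw : w.Nodup) : antipodeMap K (Fw K w) = antipodeWord K w := by
  obtain ⟨f, hf, e⟩ := exists_word_std w hw
  rw [antipodeMap, Fw, Module.Basis.constr_basis, e, antipodeWord_map K w f hf]

theorem antipodeMap'_Fw {w : List ℕ} (hw : w.Nodup) :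
    antipodeMap' K (Fw K w) = antipodeWord' K w := by
  obtain ⟨f, hf, e⟩ := exists_word_std w hw
  rw [antipodeMap', Fw, Module.Basis.constr_basis, e, antipodeWord'_map K w f hf]

theorem antipode_left : LinearMap.mul' K (FQSym K) ∘ₗ (antipodeMap K).rTensor (FQSym K) ∘ₗ
    comul (R := K) = Algebra.linearMap K (FQSym K) ∘ₗ counit (R := K) := by
  refine (F K).ext fun σ => ?_
  have hw := word_nodup σ
  rw [F_eq]
  generalize word σ = w at *
  refine (map_comul_Fw K (LinearMap.mul' K (FQSym K) ∘ₗ (antipodeMap K).rTensor (FQSym K))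
    hw).trans ?_
  have : cutSum (fun x y => antipodeWord K x * Fw K y) w =
      (Algebra.linearMap K (FQSym K) ∘ₗ counit (R := K)) (Fw K w) := by
    rw [LinearMap.comp_apply, counit_F]
    by_cases h : w = []
    · subst h
      rw [cutSum_nil, antipodeWord, ← one_eq]
      simp
    · rw [if_neg h, map_zero, cutSum, Finset.sum_range_succ, ← Fin.sum_univ_eq_sum_range
        (fun i => antipodeWord K (w.take i) * Fw K (w.drop i)), List.take_length, List.drop_length,
        ← one_eq, mul_one]
      conv_lhs => rw [antipodeWord, if_neg h]
      exact add_neg_cancel _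
  rw [← this]
  refine cutSum_congr fun x y hxy => ?_
  subst hxy
  rw [LinearMap.comp_apply, LinearMap.rTensor_tmul, antipodeMap_Fw K hw.of_append_left]
  rfl

theorem antipode_right' : LinearMap.mul' K (FQSym K) ∘ₗ (antipodeMap' K).lTensor (FQSym K) ∘ₗ
    comul (R := K) = Algebra.linearMap K (FQSym K) ∘ₗ counit (R := K) := by
  refine (F K).ext fun σ => ?_
  have hw := word_nodup σ
  rw [F_eq]
  generalize word σ = w at *
  refine (map_comul_Fw K (LinearMap.mul' K (FQSym K) ∘ₗ (antipodeMap' K).lTensor (FQSym K))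
    hw).trans ?_
  have : cutSum (fun x y => Fw K x * antipodeWord' K y) w =
      (Algebra.linearMap K (FQSym K) ∘ₗ counit (R := K)) (Fw K w) := by
    rw [LinearMap.comp_apply, counit_F]
    by_cases h : w = []
    · subst h
      rw [cutSum_nil, antipodeWord', ← one_eq]
      simp
    · rw [if_neg h, map_zero, cutSum, Finset.sum_range_succ', ← Fin.sum_univ_eq_sum_range
        (fun i => Fw K (w.take (i + 1)) * antipodeWord' K (w.drop (i + 1))), List.take_zero,
        List.drop_zero, ← one_eq, one_mul]
      conv_lhs => rw [antipodeWord', if_neg h]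
      exact add_neg_cancel _
  rw [← this]
  refine cutSum_congr fun x y hxy => ?_
  subst hxy
  rw [LinearMap.comp_apply, LinearMap.lTensor_tmul, antipodeMap'_Fw K hw.of_append_right]
  rfl

theorem antipodeMap_eq : antipodeMap K = antipodeMap' K := by
  have h₁ : WithConv.toConv (antipodeMap K) * WithConv.toConv (LinearMap.id) = 1 :=
    congrArg WithConv.toConv (antipode_left K)
  have h₂ : WithConv.toConv (LinearMap.id) * WithConv.toConv (antipodeMap' K) = 1 :=
    congrArg WithConv.toConv (antipode_right' K)
  exact WithConv.toConv_injective (left_inv_eq_right_inv h₁ h₂)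

noncomputable instance : HopfAlgebra K (FQSym K) where
  antipode := antipodeMap K
  mul_antipode_rTensor_comul := antipode_left K
  mul_antipode_lTensor_comul := by rw [antipodeMap_eq]; exact antipode_right' K

end FQSym

/-- `B` is a Hopf subalgebra of `H`: a subspace that contains the unit, is closed under the product
and the antipode, and satisfies `Δ(B) ⊆ B ⊗ B`. -/
structure IsHopfSubalgebra (K : Type*) {H : Type*} [CommRing K] [Ring H] [HopfAlgebra K H]
    (B : Submodule K H) : Prop where
  one_mem : (1 : H) ∈ B
  mul_mem : ∀ x ∈ B, ∀ y ∈ B, x * y ∈ B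
  comul_mem : ∀ x ∈ B, Coalgebra.comul (R := K) x ∈ LinearMap.range (TensorProduct.mapIncl B B)
  antipode_mem : ∀ x ∈ B, HopfAlgebra.antipode K x ∈ B

/-! ### Pairs of twin binary trees -/

/-- The orientations of the leaves of a binary tree, from left to right: `true` (the digit `1`) for
a leaf that is a left child and `false` (the digit `0`) for a leaf that is a right child. The
argument `d` is the orientation of the tree itself. -/
def leafWord (d : Bool) : BinaryTree Unit → List Bool
  | .nil => [d]
  | .node _ l r => leafWord true l ++ leafWord false r

/-- The canopy: the orientations of all leaves except the first and the last one. (The orientation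
given to the root is irrelevant.) -/
def canopy (T : BinaryTree Unit) : List Bool := (leafWord true T).tail.dropLast

/-- Pairs of (unlabeled) twin binary trees: two binary trees with the same number of nodes whose
canopies are complementary. -/
structure TwinBinaryTrees where
  left : BinaryTree Unit
  right : BinaryTree Unit
  numNodes_eq : left.numNodes = right.numNodes
  canopy_ne : List.Forall₂ (· ≠ ·) (canopy left) (canopy right)

/-- Leaf insertion of the letter `a` into a left binary search tree. -/
def leafInsert (a : ℕ) : BinaryTree ℕ → BinaryTree ℕ
  | .nil => .node a .nil .nil
  | .node b l r => if a < b then .node b (leafInsert a l) r else .node b l (leafInsert a r)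

/-- The lower restricted tree `T_{≤ b}` of a right binary search tree. -/
def lowerRestrict (b : ℕ) : BinaryTree ℕ → BinaryTree ℕ
  | .nil => .nil
  | .node a l r => if a ≤ b then .node a l (lowerRestrict b r) else lowerRestrict b l

/-- The higher restricted tree `T_{> b}` of a right binary search tree. -/
def higherRestrict (b : ℕ) : BinaryTree ℕ → BinaryTree ℕ
  | .nil => .nil
  | .node a l r => if a ≤ b then higherRestrict b r else .node a (higherRestrict b l) r

/-- Root insertion of the letter `a` into a right binary search tree. -/
def rootInsert (a : ℕ) (T : BinaryTree ℕ) : BinaryTree ℕ :=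
  .node a (lowerRestrict a T) (higherRestrict a T)

/-- The `P`-symbol of a word: the letters are inserted from left to right, starting from the pair
of empty trees, by leaf insertion into the first tree and by root insertion into the second. -/
def pSymbol (w : List ℕ) : BinaryTree ℕ × BinaryTree ℕ :=
  w.foldl (fun T a => (leafInsert a T.1, rootInsert a T.2)) (.nil, .nil)

/-- The shape of a labeled binary tree. -/
def shape (T : BinaryTree ℕ) : BinaryTree Unit := T.map fun _ => ()

/-- The `P`-symbol of the permutation `σ` is `J`, where, as permutations have distinct letters
`1, …, n`, the `P`-symbol is identified with its shape. -/
def HasPSymbol (σ : Permutation) (J : TwinBinaryTrees) : Prop :=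
  shape (pSymbol (word σ)).1 = J.left ∧ shape (pSymbol (word σ)).2 = J.right

theorem HasPSymbol.size_eq {σ : Permutation} {J : TwinBinaryTrees} (h : HasPSymbol σ J) :
    σ.1 = J.left.numNodes := by
  have e1 : ∀ (a : ℕ) (T : BinaryTree ℕ), (leafInsert a T).numNodes = T.numNodes + 1 := by
    intro a T
    induction T with
    | nil => simp [leafInsert]
    | node b l r hl hr =>
      rw [leafInsert]
      split_ifs <;> simp [hl, hr] <;> omega
  have e2 : ∀ (w : List ℕ) (T : BinaryTree ℕ × BinaryTree ℕ),
      (w.foldl (fun T a => (leafInsert a T.1, rootInsert a T.2)) T).1.numNodes =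
        T.1.numNodes + w.length := by
    intro w
    induction w with
    | nil => simp
    | cons a w ih => intro T; rw [List.foldl_cons, ih]; simp [e1]; omega
  have e3 : ∀ T : BinaryTree ℕ, (shape T).numNodes = T.numNodes := by
    intro T
    induction T with
    | nil => rfl
    | node b l r hl hr => simp only [shape] at *; simp [BinaryTree.map, hl, hr]
  rw [← h.1, e3, pSymbol, e2, length_word]
  simp

open Classical in
/-- `P_J`, the sum of the `F_σ` over the permutations `σ` with `P`-symbol `J`; by
`HasPSymbol.size_eq` all of them have size the number of nodes of the trees of `J`. -/
noncomputable def FQSym.P (K : Type*) [CommRing K] (J : TwinBinaryTrees) : FQSym K :=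
  ∑ s : Equiv.Perm (Fin J.left.numNodes),
    if HasPSymbol ⟨J.left.numNodes, s⟩ J then FQSym.F K ⟨J.left.numNodes, s⟩ else 0

/-- `Baxter`, the span of the `P_J`. -/
noncomputable def Baxter (K : Type*) [CommRing K] : Submodule K (FQSym K) :=
  Submodule.span K (Set.range (FQSym.P K))

end BaxterHopf

/-!
The `P`-symbol of a word without repeated letters consists of two search trees of the same kind.
Let `bst w` be the tree obtained by leaf insertion of the letters of `w` from left to right. Root
insertion of the letters from left to right is leaf insertion from right to left, so the `P`-symbol
of `w` is the pair `(bst w, bst w.reverse)` (`pSymbol_eq`). Each property of `P`-symbols below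
reduces to one of `bst`:

* the symbol of `w` determines those of its restrictions to the letters `≤ b` and `> b`, since
  `lowerRestrict` and `higherRestrict` compute them (`bst_filter_le`, `bst_filter_not_le`);
* the symbols of `u` and `v` determine that of `u ++ v` (`bst_append_congr`);
* an increasing relabeling of the letters relabels the symbol (`bst_map`);
* once the set of letters is given, the shapes determine the symbol, because the labels in symmetric
  order are increasing (`pSymbol_eq_iff_shape_eq`);
* the shapes form a pair of twin binary trees: the leaf between consecutive letters `x < y` is a
  left child in `bst w` exactly when `x` precedes `y` in `w`, and reversing `w` exchanges the two
  cases (`exists_twinBinaryTrees`).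

For a finite set `B` of letters, `classSum B T` is the sum of the `F_{std(w)}` over the words `w`
on `B` with symbol `T`. By the last three properties, each class sum is zero or some `P_J`, and each
`P_J` is zero or a class sum on any interval of the right length. A combination of the `F_{std(w)}`
over the words on `B` lies in `Baxter` as soon as its coefficients depend only on the symbols
(`sum_mem_of_pSymbol_congr`).

A product of two class sums on consecutive intervals is the sum over the words on the union whose
two restrictions have prescribed symbols, so restriction gives closure under the product
(`classSum_mul_mem`). The words of a class, cut after `i` letters, are the pairs of words on
complementary sets of letters whose concatenation has a prescribed symbol, so concatenation gives
the statement on the coproduct (`sum_cut_mem`). The antipode follows by induction on the number of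
letters, from the recursion that defines it.
-/

namespace BaxterHopf

/-! ### Binary search trees of words -/

/-- The binary search tree obtained by leaf insertion of the letters of `w`, from left to right. -/
def bst (w : List ℕ) : BinaryTree ℕ := w.foldl (fun T a => leafInsert a T) .nil

theorem foldl_leafInsert_node (a : ℕ) (l r : BinaryTree ℕ) (w : List ℕ) :
    w.foldl (fun T a => leafInsert a T) (.node a l r) =
      .node a ((w.filter (· < a)).foldl (fun T a => leafInsert a T) l)
        ((w.filter (¬ · < a)).foldl (fun T a => leafInsert a T) r) := by
  induction w generalizing l r with
  | nil => rfl
  | cons b w ih =>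
    rw [List.foldl_cons, leafInsert]
    split_ifs with h
    · rw [ih]; simp [h]
    · rw [ih]; simp [h, not_lt.1 h]

theorem bst_cons (a : ℕ) (w : List ℕ) :
    bst (a :: w) = .node a (bst (w.filter (· < a))) (bst (w.filter (¬ · < a))) :=
  foldl_leafInsert_node a .nil .nil w

theorem bst_append (u v : List ℕ) :
    bst (u ++ v) = v.foldl (fun T a => leafInsert a T) (bst u) := List.foldl_append

theorem bst_concat (w : List ℕ) (a : ℕ) : bst (w ++ [a]) = leafInsert a (bst w) :=
  bst_append w [a]

/-- Induction along the recursive construction of `bst`. -/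
theorem bst_induction {p : List ℕ → Prop} (nil : p [])
    (cons : ∀ a w, p (w.filter (· < a)) → p (w.filter (¬ · < a)) → p (a :: w)) (w : List ℕ) :
    p w := by
  induction h : w.length using Nat.strong_induction_on generalizing w with
  | _ n ih =>
    subst h
    cases w with
    | nil => exact nil
    | cons a w =>
      exact cons a w (ih _ (Nat.lt_succ_of_le (List.length_filter_le _ _)) _ rfl)
        (ih _ (Nat.lt_succ_of_le (List.length_filter_le _ _)) _ rfl)

theorem lowerRestrict_leafInsert (a b : ℕ) (T : BinaryTree ℕ) :
    lowerRestrict b (leafInsert a T) =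
      if a ≤ b then leafInsert a (lowerRestrict b T) else lowerRestrict b T := by
  induction T with
  | nil => by_cases h : a ≤ b <;> simp [leafInsert, lowerRestrict, h]
  | node c l r hl hr =>
    by_cases h : a < c <;> by_cases hc : c ≤ b <;> by_cases hb : a ≤ b <;>
      grind [leafInsert, lowerRestrict]

theorem higherRestrict_leafInsert (a b : ℕ) (T : BinaryTree ℕ) :
    higherRestrict b (leafInsert a T) =
      if a ≤ b then higherRestrict b T else leafInsert a (higherRestrict b T) := by
  induction T with
  | nil => by_cases h : a ≤ b <;> simp [leafInsert, higherRestrict, h]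
  | node c l r hl hr =>
    by_cases h : a < c <;> by_cases hc : c ≤ b <;> by_cases hb : a ≤ b <;>
      grind [leafInsert, higherRestrict]

theorem bst_filter_le (b : ℕ) (w : List ℕ) :
    bst (w.filter (· ≤ b)) = lowerRestrict b (bst w) := by
  induction w using List.reverseRecOn with
  | nil => rfl
  | append_singleton w a ih =>
    rw [bst_concat, lowerRestrict_leafInsert, ← ih, List.filter_append]
    split_ifs with h <;> simp [h, bst_append]

theorem bst_filter_not_le (b : ℕ) (w : List ℕ) :
    bst (w.filter (¬ · ≤ b)) = higherRestrict b (bst w) := by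
  induction w using List.reverseRecOn with
  | nil => rfl
  | append_singleton w a ih =>
    rw [bst_concat, higherRestrict_leafInsert, ← ih, List.filter_append]
    split_ifs with h
    · simp [h]
    · simp [bst_append, not_le.1 h]

/-- Words with the same search tree have restrictions with the same search tree. -/
theorem bst_filter_lt_congr {u v : List ℕ} (h : bst u = bst v) (a : ℕ) :
    bst (u.filter (· < a)) = bst (v.filter (· < a)) ∧
      bst (u.filter (¬ · < a)) = bst (v.filter (¬ · < a)) := by
  cases a with
  | zero => simpa using h
  | succ a =>
    simp only [Nat.lt_succ_iff]
    rw [bst_filter_le, bst_filter_le, bst_filter_not_le, bst_filter_not_le, h]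
    exact ⟨rfl, rfl⟩

theorem bst_append_congr {u u' v v' : List ℕ} (hu : bst u = bst u') (hv : bst v = bst v') :
    bst (u ++ v) = bst (u' ++ v') := by
  have key : bst (u ++ v) = bst (u ++ v') := by
    clear hu
    induction u with
    | nil => exact hv
    | cons a u ih =>
      rw [List.cons_append, List.cons_append, bst_cons, bst_cons, (bst_filter_lt_congr ih a).1,
        (bst_filter_lt_congr ih a).2]
  rw [key, bst_append, bst_append, hu]

theorem bst_map {f : ℕ → ℕ} {w : List ℕ} (hf : StrictMonoOn f {x | x ∈ w}) :
    bst (w.map f) = (bst w).map f := by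
  induction w using bst_induction with
  | nil => rfl
  | cons a w ih₁ ih₂ =>
    have hlt : ∀ x ∈ w, (f x < f a ↔ x < a) := fun x hx =>
      hf.lt_iff_lt (List.mem_cons_of_mem _ hx) List.mem_cons_self
    have e₁ : (w.map f).filter (· < f a) = (w.filter (· < a)).map f := by
      rw [List.filter_map]
      exact congrArg _ (List.filter_congr fun x hx => by simp [hlt x hx])
    have e₂ : (w.map f).filter (¬ · < f a) = (w.filter (¬ · < a)).map f := by
      rw [List.filter_map]
      refine congrArg _ (List.filter_congr fun x hx => ?_)
      simpa using not_congr (hlt x hx)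
    rw [List.map_cons, bst_cons, bst_cons, e₁, e₂,
      ih₁ (hf.mono fun x hx => List.mem_cons_of_mem _ (List.mem_of_mem_filter hx)),
      ih₂ (hf.mono fun x hx => List.mem_cons_of_mem _ (List.mem_of_mem_filter hx))]
    rfl

/-- The labels of a binary tree, in symmetric order. -/
def inorder : BinaryTree ℕ → List ℕ
  | .nil => []
  | .node a l r => inorder l ++ a :: inorder r

theorem inorder_bst_perm (w : List ℕ) : (inorder (bst w)).Perm w := by
  induction w using bst_induction with
  | nil => rfl
  | cons a w ih₁ ih₂ =>
    rw [bst_cons, inorder]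
    refine List.perm_middle.trans (List.Perm.cons a ((ih₁.append ih₂).trans ?_))
    simpa only [decide_not] using List.filter_append_perm (· < a) w

theorem inorder_bst_pairwise (w : List ℕ) : (inorder (bst w)).Pairwise (· ≤ ·) := by
  induction w using bst_induction with
  | nil => exact .nil
  | cons a w ih₁ ih₂ =>
    rw [bst_cons, inorder, List.pairwise_append, List.pairwise_cons]
    have h₁ : ∀ x ∈ inorder (bst (w.filter (· < a))), x < a := fun x hx => by
      simpa using (List.mem_filter.1 ((inorder_bst_perm _).subset hx)).2
    have h₂ : ∀ x ∈ inorder (bst (w.filter (¬ · < a))), a ≤ x := fun x hx => by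
      simpa using (List.mem_filter.1 ((inorder_bst_perm _).subset hx)).2
    refine ⟨ih₁, ⟨h₂, ih₂⟩, fun x hx y hy => ?_⟩
    rcases List.mem_cons.1 hy with rfl | hy
    · exact (h₁ x hx).le
    · exact (h₁ x hx).le.trans (h₂ y hy)

theorem inorder_bst_congr {u v : List ℕ} (h : u.Perm v) : inorder (bst u) = inorder (bst v) :=
  List.Perm.eq_of_pairwise (le := (· ≤ ·)) (fun _ _ _ _ => le_antisymm)
    (inorder_bst_pairwise u) (inorder_bst_pairwise v)
    ((inorder_bst_perm u).trans (h.trans (inorder_bst_perm v).symm))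

theorem shape_node (a : ℕ) (l r : BinaryTree ℕ) :
    shape (.node a l r) = .node () (shape l) (shape r) := rfl

theorem shape_map (f : ℕ → ℕ) (T : BinaryTree ℕ) : shape (T.map f) = shape T := by
  rw [shape, shape, ← BinaryTree.comp_map]

theorem length_inorder (T : BinaryTree ℕ) : (inorder T).length = (shape T).numNodes := by
  induction T with
  | nil => rfl
  | node a l r hl hr => simp [inorder, shape_node, hl, hr, Nat.add_assoc]

/-- A labeled tree is determined by its shape and its labels in symmetric order. -/
theorem eq_of_shape_eq {S T : BinaryTree ℕ} (h : shape S = shape T)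
    (h' : inorder S = inorder T) : S = T := by
  induction S generalizing T with
  | nil =>
    cases T with
    | nil => rfl
    | node => simp [shape, BinaryTree.map] at h
  | node a l r hl hr =>
    cases T with
    | nil => simp [shape, BinaryTree.map] at h
    | node b l' r' =>
      rw [shape_node, shape_node] at h
      injection h with _ e₁ e₂
      obtain ⟨i₁, i₂⟩ := List.append_inj h' (by rw [length_inorder, length_inorder, e₁])
      injection i₂ with i₂ i₃
      rw [hl e₁ i₁, hr e₂ i₃, i₂]

theorem bst_eq_of_shape_eq {u v : List ℕ} (h : u.Perm v)
    (hs : shape (bst u) = shape (bst v)) : bst u = bst v :=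
  eq_of_shape_eq hs (inorder_bst_congr h)

/-! ### Canopies -/

/-- The values of `p` at the pairs of consecutive letters of a word. -/
def adjacentBits (p : ℕ → ℕ → Bool) : List ℕ → List Bool
  | [] => []
  | [_] => []
  | x :: y :: s => p x y :: adjacentBits p (y :: s)

theorem adjacentBits_append_cons (p : ℕ → ℕ → Bool) (u : List ℕ) (a : ℕ) (v : List ℕ) :
    adjacentBits p (u ++ a :: v) = adjacentBits p (u ++ [a]) ++ adjacentBits p (a :: v) := by
  induction u with
  | nil => simp [adjacentBits]
  | cons x u ih => cases u <;> simp_all [adjacentBits]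

theorem adjacentBits_congr {p q : ℕ → ℕ → Bool} {s : List ℕ}
    (h : ∀ x ∈ s, ∀ y ∈ s, p x y = q x y) : adjacentBits p s = adjacentBits q s := by
  induction s with
  | nil => rfl
  | cons x s ih =>
    cases s with
    | nil => rfl
    | cons y s =>
      rw [adjacentBits, adjacentBits, h x (by simp) y (by simp),
        ih fun a ha b hb => h a (List.mem_cons_of_mem _ ha) b (List.mem_cons_of_mem _ hb)]

/-- For any two letters `x` and `y` at distinct positions of `w`, `p x y` tells whether `x` stands
on the left of `y`. (In particular, `w` has no repeated letter.) -/
def IsOrderOf (p : ℕ → ℕ → Bool) (w : List ℕ) : Prop :=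
  w.Pairwise fun x y => p x y = true ∧ p y x = false

/-- The leaf between two consecutive labels `x < y` of a search tree hangs from the one that was
inserted last: it is a left child exactly when `x` comes first. The labels `lo` and `hi` stand for
ancestors that bound the tree on both sides. -/
theorem leafWord_bst {p : ℕ → ℕ → Bool} {w : List ℕ} (hp : IsOrderOf p w) {lo hi : ℕ}
    (hlo : ∀ x ∈ w, p lo x = true) (hhi : ∀ x ∈ w, p x hi = false) :
    leafWord (p lo hi) (shape (bst w)) = adjacentBits p (lo :: inorder (bst w) ++ [hi]) := by
  induction w using bst_induction generalizing lo hi with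
  | nil => rfl
  | cons a w ih₁ ih₂ =>
    obtain ⟨ha, hw⟩ := List.pairwise_cons.1 hp
    have i₁ := ih₁ (hw.filter _) (lo := lo) (hi := a)
      (fun x hx => hlo x (List.mem_cons_of_mem _ (List.mem_of_mem_filter hx)))
      (fun x hx => (ha x (List.mem_of_mem_filter hx)).2)
    have i₂ := ih₂ (hw.filter _) (lo := a) (hi := hi)
      (fun x hx => (ha x (List.mem_of_mem_filter hx)).1)
      (fun x hx => hhi x (List.mem_cons_of_mem _ (List.mem_of_mem_filter hx)))
    rw [hlo a List.mem_cons_self] at i₁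
    rw [hhi a List.mem_cons_self] at i₂
    rw [bst_cons, shape_node, leafWord, i₁, i₂, inorder, ← List.cons_append,
      List.append_assoc, List.cons_append, List.cons_append,
      adjacentBits_append_cons p (lo :: _) a]
    rfl

theorem canopy_bst {p : ℕ → ℕ → Bool} {w : List ℕ} (hp : IsOrderOf p w) :
    canopy (shape (bst w)) = adjacentBits p (inorder (bst w)) := by
  -- Two letters outside `w` are added, to stand for ancestors on both sides of the tree.
  obtain ⟨lo, hlo⟩ := Infinite.exists_notMem_finset w.toFinset
  obtain ⟨hi, hhi⟩ := Infinite.exists_notMem_finset (insert lo w.toFinset)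
  rw [Finset.mem_insert, not_or] at hhi
  rw [List.mem_toFinset] at hlo hhi
  let q : ℕ → ℕ → Bool := fun x y => if x = lo then true else if y = hi then false else p x y
  have hpq : ∀ x ∈ w, ∀ y ∈ w, p x y = q x y := fun x hx y hy => by
    have h₁ : x ≠ lo := fun h => hlo (h ▸ hx)
    have h₂ : y ≠ hi := fun h => hhi.2 (h ▸ hy)
    simp [q, h₁, h₂]
  have hq : IsOrderOf q w := hp.imp_of_mem fun {x y} hx hy h => by
    rwa [← hpq x hx y hy, ← hpq y hy x hx]
  have key := leafWord_bst hq (lo := lo) (hi := hi) (fun x _ => by simp [q])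
    (fun x hx => by
      have h₁ : x ≠ lo := fun h => hlo (h ▸ hx)
      simp [q, h₁])
  have hs := adjacentBits_congr (s := inorder (bst w)) fun x hx y hy =>
    hpq x ((inorder_bst_perm w).subset hx) y ((inorder_bst_perm w).subset hy)
  rw [show q lo hi = true by simp [q]] at key
  rw [canopy, key, hs]
  rcases inorder (bst w) with _ | ⟨x, s⟩
  · rfl
  · rcases List.eq_nil_or_concat' (x :: s) with h | ⟨s', y, h⟩
    · simp at h
    · rw [List.cons_append, List.cons_append, adjacentBits, List.tail_cons, ← List.cons_append, h,
        List.append_assoc, List.singleton_append, adjacentBits_append_cons]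
      simp [adjacentBits]

/-! ### The `P`-symbol of a word without repeated letters -/

/-- Root insertion from left to right amounts to leaf insertion from right to left. -/
theorem pSymbol_eq {w : List ℕ} (hw : w.Nodup) : pSymbol w = (bst w, bst w.reverse) := by
  induction w using List.reverseRecOn with
  | nil => rfl
  | append_singleton w a ih =>
    rw [List.nodup_append] at hw
    have ha : ∀ x ∈ w, x ≠ a := fun x hx => hw.2.2 x hx a (by simp)
    have e : ∀ x ∈ w.reverse, (x ≤ a ↔ x < a) := fun x hx => by
      have := ha x (List.mem_reverse.1 hx)
      omega
    have e₁ : w.reverse.filter (· < a) = w.reverse.filter (· ≤ a) :=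
      List.filter_congr fun x hx => by simp [e x hx]
    have e₂ : w.reverse.filter (¬ · < a) = w.reverse.filter (¬ · ≤ a) :=
      List.filter_congr fun x hx => by simp [e x hx, -not_lt, -not_le]
    have h : pSymbol (w ++ [a]) = (leafInsert a (pSymbol w).1, rootInsert a (pSymbol w).2) :=
      List.foldl_append
    rw [h, ih hw.1, List.reverse_append, List.reverse_singleton, List.singleton_append, bst_concat,
      bst_cons, e₁, e₂, bst_filter_le, bst_filter_not_le, rootInsert]

theorem pSymbol_filter_le_congr {u v : List ℕ} (hu : u.Nodup) (hv : v.Nodup)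
    (h : pSymbol u = pSymbol v) (b : ℕ) :
    pSymbol (u.filter (· ≤ b)) = pSymbol (v.filter (· ≤ b)) := by
  rw [pSymbol_eq hu, pSymbol_eq hv, Prod.mk.injEq] at h
  rw [pSymbol_eq (hu.filter _), pSymbol_eq (hv.filter _), ← List.filter_reverse,
    ← List.filter_reverse, bst_filter_le, bst_filter_le, bst_filter_le, bst_filter_le, h.1, h.2]

theorem pSymbol_filter_not_le_congr {u v : List ℕ} (hu : u.Nodup) (hv : v.Nodup)
    (h : pSymbol u = pSymbol v) (b : ℕ) :
    pSymbol (u.filter (¬ · ≤ b)) = pSymbol (v.filter (¬ · ≤ b)) := by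
  rw [pSymbol_eq hu, pSymbol_eq hv, Prod.mk.injEq] at h
  rw [pSymbol_eq (hu.filter _), pSymbol_eq (hv.filter _), ← List.filter_reverse,
    ← List.filter_reverse, bst_filter_not_le, bst_filter_not_le, bst_filter_not_le,
    bst_filter_not_le, h.1, h.2]

theorem pSymbol_append_congr {u u' v v' : List ℕ} (h : (u ++ v).Nodup) (h' : (u' ++ v').Nodup)
    (hu : pSymbol u = pSymbol u') (hv : pSymbol v = pSymbol v') :
    pSymbol (u ++ v) = pSymbol (u' ++ v') := by
  rw [pSymbol_eq h.of_append_left, pSymbol_eq h'.of_append_left, Prod.mk.injEq] at hu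
  rw [pSymbol_eq h.of_append_right, pSymbol_eq h'.of_append_right, Prod.mk.injEq] at hv
  rw [pSymbol_eq h, pSymbol_eq h', List.reverse_append, List.reverse_append,
    bst_append_congr hu.1 hv.1, bst_append_congr hv.2 hu.2]

theorem pSymbol_map {f : ℕ → ℕ} {w : List ℕ} (hw : w.Nodup)
    (hf : StrictMonoOn f {x | x ∈ w}) :
    pSymbol (w.map f) = ((pSymbol w).1.map f, (pSymbol w).2.map f) := by
  rw [pSymbol_eq hw, pSymbol_eq (hw.map_on fun x hx y hy => hf.injOn hx hy),
    ← List.map_reverse, bst_map hf, bst_map (hf.mono fun x hx => List.mem_reverse.1 hx)]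

/-- For words on the same set of letters, the `P`-symbol carries as much information as its pair
of shapes. -/
theorem pSymbol_eq_iff_shape_eq {u v : List ℕ} (hu : u.Nodup) (h : u.Perm v) :
    pSymbol u = pSymbol v ↔
      shape (pSymbol u).1 = shape (pSymbol v).1 ∧ shape (pSymbol u).2 = shape (pSymbol v).2 := by
  refine ⟨fun e => by rw [e]; exact ⟨rfl, rfl⟩, fun e => ?_⟩
  rw [pSymbol_eq hu, pSymbol_eq (h.nodup_iff.1 hu)] at e ⊢
  rw [bst_eq_of_shape_eq h e.1,
    bst_eq_of_shape_eq ((u.reverse_perm.trans h).trans v.reverse_perm.symm) e.2]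

/-- The pair of shapes of a `P`-symbol is a pair of twin binary trees: reversing a word exchanges
the two possible orders of any two letters, hence the two orientations of every inner leaf. -/
theorem exists_twinBinaryTrees {w : List ℕ} (hw : w.Nodup) :
    ∃ J : TwinBinaryTrees, shape (pSymbol w).1 = J.left ∧ shape (pSymbol w).2 = J.right := by
  let p : ℕ → ℕ → Bool := fun x y => decide (w.idxOf x < w.idxOf y)
  have hp : IsOrderOf p w := by
    rw [IsOrderOf, List.pairwise_iff_getElem]
    intro i j hi hj hij
    simp [p, hw.idxOf_getElem, hij, hij.le]
  have hq : IsOrderOf (fun x y => !p x y) w.reverse :=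
    List.pairwise_reverse.2 (hp.imp fun h => by simp [h.1, h.2])
  have hi : inorder (bst w.reverse) = inorder (bst w) := inorder_bst_congr w.reverse_perm
  rw [pSymbol_eq hw]
  refine ⟨⟨_, _, ?_, ?_⟩, rfl, rfl⟩
  · exact (length_inorder _).symm.trans ((congrArg List.length hi.symm).trans (length_inorder _))
  · refine (canopy_bst hp).symm ▸ (canopy_bst hq).symm ▸ hi.symm ▸ ?_
    generalize inorder (bst w) = s
    induction s with
    | nil => exact .nil
    | cons x s ih =>
      cases s with
      | nil => exact .nil
      | cons y s => exact .cons (by simp) ih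

/-! ### Sums over the words on a set of letters -/

/-- The words in which each letter of `B` occurs exactly once, and no other letter occurs. -/
def wordsOn (B : Finset ℕ) : Finset (List ℕ) := ⟨B.val.lists, Multiset.lists_nodup_finset B⟩

theorem mem_wordsOn {B : Finset ℕ} {w : List ℕ} : w ∈ wordsOn B ↔ w.Nodup ∧ w.toFinset = B := by
  change w ∈ B.val.lists ↔ _
  rw [Multiset.mem_lists_iff]
  constructor
  · intro h
    have hw : w.Nodup := by
      have := B.nodup
      rwa [h] at this
    refine ⟨hw, Finset.val_injective ?_⟩
    rw [h, List.toFinset_val, hw.dedup]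
    rfl
  · rintro ⟨hw, rfl⟩
    rw [List.toFinset_val, hw.dedup]
    rfl

theorem mem_wordsOn_of_perm {B : Finset ℕ} {u v : List ℕ} (hu : u ∈ wordsOn B) (h : v.Perm u) :
    v ∈ wordsOn B := by
  rw [mem_wordsOn] at hu ⊢
  exact ⟨h.nodup_iff.2 hu.1, (List.toFinset_eq_of_perm _ _ h).trans hu.2⟩

theorem perm_of_mem_wordsOn {B : Finset ℕ} {u v : List ℕ} (hu : u ∈ wordsOn B)
    (hv : v ∈ wordsOn B) : u.Perm v := by
  rw [mem_wordsOn] at hu hv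
  exact List.perm_of_nodup_nodup_toFinset_eq hu.1 hv.1 (hu.2.trans hv.2.symm)

theorem length_of_mem_wordsOn {B : Finset ℕ} {w : List ℕ} (h : w ∈ wordsOn B) :
    w.length = B.card := by
  rw [mem_wordsOn] at h
  rw [← h.2, List.toFinset_card_of_nodup h.1]

theorem append_mem_wordsOn {B C : Finset ℕ} (h : Disjoint B C) {u v : List ℕ}
    (hu : u ∈ wordsOn B) (hv : v ∈ wordsOn C) : u ++ v ∈ wordsOn (B ∪ C) := by
  rw [mem_wordsOn] at *
  obtain ⟨hu, rfl⟩ := hu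
  obtain ⟨hv, rfl⟩ := hv
  rw [List.toFinset_append, List.nodup_append']
  exact ⟨⟨hu, hv, List.disjoint_toFinset_iff_disjoint.1 h⟩, rfl⟩

section Sums

variable {M : Type*} [AddCommMonoid M]

/-- Cutting the words on `B` after `i` letters gives all pairs of words on two complementary
subsets of `B`, the first one of cardinality `i`. -/
theorem sum_wordsOn_cut (G : List ℕ → List ℕ → M) (B : Finset ℕ) {i : ℕ} (hi : i ≤ B.card) :
    ∑ w ∈ wordsOn B, G (w.take i) (w.drop i) =
      ∑ C ∈ B.powersetCard i, ∑ u ∈ wordsOn C, ∑ v ∈ wordsOn (B \ C), G u v := by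
  simp_rw [Finset.sum_sigma']
  refine Finset.sum_bij' (fun w _ => ⟨(w.take i).toFinset, w.take i, w.drop i⟩)
    (fun x _ => x.2.1 ++ x.2.2) ?_ ?_ (fun w _ => List.take_append_drop i w) ?_ (fun _ _ => rfl)
  · intro w hw
    have hl := length_of_mem_wordsOn hw
    obtain ⟨hnd, rfl⟩ := mem_wordsOn.1 hw
    rw [← List.take_append_drop i w, List.nodup_append'] at hnd
    simp only [Finset.mem_sigma, Finset.mem_powersetCard, mem_wordsOn]
    refine ⟨⟨fun x hx => ?_, ?_⟩, ⟨hnd.1, trivial⟩, hnd.2.1, ?_⟩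
    · rw [List.mem_toFinset] at hx ⊢
      exact List.mem_of_mem_take hx
    · rw [List.toFinset_card_of_nodup hnd.1, List.length_take, hl, min_eq_left hi]
    · conv_rhs => enter [1]; rw [← List.take_append_drop i w]
      rw [List.toFinset_append, Finset.union_sdiff_left,
        Finset.sdiff_eq_self_of_disjoint (List.disjoint_toFinset_iff_disjoint.2 hnd.2.2).symm]
  · rintro ⟨C, u, v⟩ h
    simp only [Finset.mem_sigma, Finset.mem_powersetCard] at h
    have := append_mem_wordsOn Finset.disjoint_sdiff h.2.1 h.2.2
    rwa [Finset.union_sdiff_of_subset h.1.1] at this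
  · rintro ⟨C, u, v⟩ h
    simp only [Finset.mem_sigma, Finset.mem_powersetCard] at h
    have hl : u.length = i := (length_of_mem_wordsOn h.2.1).trans h.1.2
    subst hl
    simp [(mem_wordsOn.1 h.2.1).2]

theorem mem_shuffle_iff (p : ℕ → Prop) [DecidablePred p] {u v w : List ℕ} (hu : ∀ x ∈ u, p x)
    (hv : ∀ x ∈ v, ¬p x) : w ∈ shuffle u v ↔ w.filter p = u ∧ w.filter (¬p ·) = v := by
  induction w generalizing u v with
  | nil =>
    constructor
    · intro h
      have := (perm_of_mem_shuffle h).length_eq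
      cases u <;> cases v <;> simp_all
    · rintro ⟨rfl, rfl⟩
      simp [shuffle_nil_left]
  | cons c w ih =>
    rcases u with _ | ⟨a, u⟩
    · rw [shuffle_nil_left, List.mem_singleton]
      constructor
      · rintro rfl
        exact ⟨List.filter_eq_nil_iff.2 (by simpa using hv),
          List.filter_eq_self.2 (by simpa using hv)⟩
      · rintro ⟨h₁, rfl⟩
        refine (List.filter_eq_self.2 fun x hx => ?_).symm
        simpa using List.filter_eq_nil_iff.1 h₁ x hx
    · rcases v with _ | ⟨b, v⟩
      · rw [shuffle_nil_right, List.mem_singleton]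
        constructor
        · rintro h
          rw [h]
          exact ⟨List.filter_eq_self.2 (by simpa using hu),
            List.filter_eq_nil_iff.2 (by simpa using hu)⟩
        · rintro ⟨h₁, h₂⟩
          rw [← h₁]
          refine (List.filter_eq_self.2 fun x hx => ?_).symm
          simpa using List.filter_eq_nil_iff.1 h₂ x hx
      · have h₁ := ih (u := u) (v := b :: v) (fun x hx => hu x (List.mem_cons_of_mem _ hx)) hv
        have h₂ := ih (u := a :: u) (v := v) hu (fun x hx => hv x (List.mem_cons_of_mem _ hx))
        have ha := hu a List.mem_cons_self
        have hb := hv b List.mem_cons_self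
        rw [shuffle_cons_cons, List.mem_append, List.mem_map, List.mem_map]
        simp only [List.cons.injEq, exists_eq_right_right, h₁, h₂]
        by_cases hc : p c
        · have : b ≠ c := fun h => hb (h ▸ hc)
          simp only [List.filter_cons, hc, this]
          simp
          tauto
        · have : a ≠ c := fun h => hc (h ▸ ha)
          simp only [List.filter_cons, hc, this]
          simp
          tauto

theorem nodup_shuffle {u v : List ℕ} (h : u.Disjoint v) : (shuffle u v).Nodup := by
  induction u generalizing v with
  | nil => simp [shuffle_nil_left]
  | cons a u ihu =>
    induction v with
    | nil => simp [shuffle_nil_right]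
    | cons b v ihv =>
      rw [shuffle_cons_cons, List.nodup_append']
      refine ⟨(ihu (List.disjoint_of_disjoint_cons_left h)).map List.cons_injective,
        (ihv (List.disjoint_of_disjoint_cons_right h)).map List.cons_injective, fun x hx hx' => ?_⟩
      obtain ⟨y, _, rfl⟩ := List.mem_map.1 hx
      obtain ⟨z, _, e⟩ := List.mem_map.1 hx'
      injection e with e _
      exact h (a := a) (by simp) (by simp [e])

/-- When the letters of `B` are at most `b` and those of `C` are larger, each word on `B ∪ C` is a
shuffle of exactly one word on `B` and one word on `C`, namely its restrictions. -/
theorem sum_wordsOn_shuffle (G : List ℕ → List ℕ → List ℕ → M) {B C : Finset ℕ} {b : ℕ}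
    (hB : ∀ x ∈ B, x ≤ b) (hC : ∀ x ∈ C, ¬x ≤ b) :
    ∑ u ∈ wordsOn B, ∑ v ∈ wordsOn C, shuffleSum (G u v) u v =
      ∑ w ∈ wordsOn (B ∪ C), G (w.filter (· ≤ b)) (w.filter (¬ · ≤ b)) w := by
  have hBC : Disjoint B C := Finset.disjoint_left.2 fun x h h' => hC x h' (hB x h)
  have hp : ∀ u ∈ wordsOn B, ∀ x ∈ u, x ≤ b := fun u hu x hx =>
    hB x ((mem_wordsOn.1 hu).2 ▸ List.mem_toFinset.2 hx)
  have hn : ∀ v ∈ wordsOn C, ∀ x ∈ v, ¬x ≤ b := fun v hv x hx =>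
    hC x ((mem_wordsOn.1 hv).2 ▸ List.mem_toFinset.2 hx)
  have e : ∑ u ∈ wordsOn B, ∑ v ∈ wordsOn C, shuffleSum (G u v) u v =
      ∑ u ∈ wordsOn B, ∑ v ∈ wordsOn C, ∑ w ∈ (shuffle u v).toFinset, G u v w :=
    Finset.sum_congr rfl fun u hu => Finset.sum_congr rfl fun v hv =>
      (List.sum_toFinset _ (nodup_shuffle fun x hx hx' => hn v hv x hx' (hp u hu x hx))).symm
  rw [e]
  simp_rw [Finset.sum_sigma']
  refine Finset.sum_bij' (fun x _ => x.2.2)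
    (fun w _ => ⟨w.filter (· ≤ b), w.filter (¬ · ≤ b), w⟩) ?_ ?_ ?_ (fun _ _ => rfl) ?_
  · rintro ⟨u, v, w⟩ h
    simp only [Finset.mem_sigma, List.mem_toFinset] at h
    exact mem_wordsOn_of_perm (append_mem_wordsOn hBC h.1 h.2.1) (perm_of_mem_shuffle h.2.2)
  · intro w hw
    obtain ⟨hw, e⟩ := mem_wordsOn.1 hw
    simp only [Finset.mem_sigma, List.mem_toFinset, mem_wordsOn]
    have hm : ∀ x, x ∈ w ↔ x ∈ B ∨ x ∈ C := fun x => by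
      rw [← List.mem_toFinset, e, Finset.mem_union]
    refine ⟨⟨hw.filter _, ?_⟩, ⟨hw.filter _, ?_⟩, ?_⟩
    · ext x
      have := hB x
      have := hC x
      simp only [List.mem_toFinset, List.mem_filter, hm, decide_eq_true_eq]
      tauto
    · ext x
      have := hB x
      have := hC x
      simp only [List.mem_toFinset, List.mem_filter, hm, decide_eq_true_eq]
      tauto
    · refine (mem_shuffle_iff (· ≤ b) ?_ ?_).2 ⟨rfl, rfl⟩
      · intro x hx
        simpa using (List.mem_filter.1 hx).2
      · intro x hx
        simpa using (List.mem_filter.1 hx).2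
  · rintro ⟨u, v, w⟩ h
    simp only [Finset.mem_sigma, List.mem_toFinset] at h
    obtain ⟨rfl, rfl⟩ := (mem_shuffle_iff (· ≤ b) (hp u h.1) (hn v h.2.1)).1 h.2.2
    rfl
  · rintro ⟨u, v, w⟩ h
    simp only [Finset.mem_sigma, List.mem_toFinset] at h
    obtain ⟨rfl, rfl⟩ := (mem_shuffle_iff (· ≤ b) (hp u h.1) (hn v h.2.1)).1 h.2.2
    rfl

end Sums

/-! ### Standardization and the elements `P_J` -/

theorem word_mem_wordsOn (σ : Permutation) : word σ ∈ wordsOn (Finset.Icc 1 σ.1) := by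
  refine mem_wordsOn.2 ⟨word_nodup σ, Finset.eq_of_subset_of_card_le (fun x hx => ?_) ?_⟩
  · exact Finset.mem_Icc.2 (mem_word (List.mem_toFinset.1 hx))
  · rw [List.toFinset_card_of_nodup (word_nodup σ), length_word]
    simp

theorem word_std {n : ℕ} {w : List ℕ} (hw : w ∈ wordsOn (Finset.Icc 1 n)) : word (std w) = w := by
  have hl : w.length = n := by simpa using length_of_mem_wordsOn hw
  obtain ⟨hnd, e⟩ := mem_wordsOn.1 hw
  subst hl
  have hm : ∀ i : Fin w.length, 1 ≤ w.get i ∧ w.get i ≤ w.length := fun i =>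
    Finset.mem_Icc.1 (e ▸ List.mem_toFinset.2 (List.get_mem w i))
  have hinj : Function.Injective fun i : Fin w.length =>
      (⟨w.get i - 1, by have := hm i; omega⟩ : Fin w.length) := fun i j h => by
    have h' := Fin.mk.inj_iff.1 h
    have := hm i
    have := hm j
    exact hnd.injective_get (by omega)
  have h : word ⟨w.length, Equiv.ofBijective _ (Finite.injective_iff_bijective.1 hinj)⟩ = w := by
    refine List.ext_get (by simp [word]) fun i h₁ h₂ => ?_
    have := (hm ⟨i, h₂⟩).1
    simp only [word, List.get_eq_getElem, List.getElem_ofFn, Equiv.ofBijective_apply] at this ⊢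
    omega
  have := congrArg word (std_word ⟨w.length,
    Equiv.ofBijective _ (Finite.injective_iff_bijective.1 hinj)⟩)
  rwa [h] at this

variable (K : Type*)

/-- The sum of the `F_{std(w)}` over the words `w` on `B` with `P`-symbol `T`. -/
noncomputable def FQSym.classSum [CommRing K] (B : Finset ℕ)
    (T : BinaryTree ℕ × BinaryTree ℕ) : FQSym K :=
  ∑ w ∈ wordsOn B with pSymbol w = T, Fw K w

open FQSym

/-- Standardization identifies the words on `B` with the permutations of size `|B|`, compatibly
with the shapes of `P`-symbols. -/
theorem classSum_eq_P [CommRing K] {B : Finset ℕ} {w₀ : List ℕ} (h₀ : w₀ ∈ wordsOn B)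
    {J : TwinBinaryTrees} (hl : shape (pSymbol w₀).1 = J.left)
    (hr : shape (pSymbol w₀).2 = J.right) : classSum K B (pSymbol w₀) = P K J := by
  classical
  have hnd := (mem_wordsOn.1 h₀).1
  have hn : w₀.length = J.left.numNodes := by
    rw [← hl, ← length_inorder, pSymbol_eq hnd, (inorder_bst_perm w₀).length_eq]
  obtain ⟨f, hf, hfw⟩ := exists_word_std w₀ hnd
  -- The increasing relabeling `f` of `B` by `1, …, |B|` standardizes all words on `B`, not only
  -- `w₀`, and its inverse `g` turns permutations back into words on `B`.
  let g := Function.invFunOn f {x | x ∈ w₀}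
  have hg : ∀ x ∈ w₀, g (f x) = x := fun x hx => hf.injOn.leftInvOn_invFunOn hx
  have hmono : ∀ w ∈ wordsOn B, StrictMonoOn f {x | x ∈ w} := fun w hw =>
    hf.mono fun x hx => (perm_of_mem_wordsOn hw h₀).subset hx
  have hword : ∀ w ∈ wordsOn B, word (std w) = w.map f := fun w hw => by
    rw [← std_map w f (hmono w hw)]
    refine word_std (mem_wordsOn_of_perm (word_mem_wordsOn (std w₀)) ?_)
    rw [hfw]
    exact (perm_of_mem_wordsOn hw h₀).map f
  have hgw : ∀ w ∈ wordsOn B, (w.map f).map g = w := fun w hw => by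
    rw [List.map_map, List.map_congr_left (f := g ∘ f) (g := id) fun x hx =>
      hg x ((perm_of_mem_wordsOn hw h₀).subset hx), List.map_id]
  have hsymb : ∀ w ∈ wordsOn B, shape (pSymbol (word (std w))).1 = shape (pSymbol w).1 ∧
      shape (pSymbol (word (std w))).2 = shape (pSymbol w).2 := fun w hw => by
    rw [hword w hw, pSymbol_map (mem_wordsOn.1 hw).1 (hmono w hw), shape_map, shape_map]
    exact ⟨rfl, rfl⟩
  have hP : P K J = ∑ σ ∈ (Finset.univ.map
      ⟨Sigma.mk (β := fun n => Equiv.Perm (Fin n)) J.left.numNodes, sigma_mk_injective⟩ :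
        Finset Permutation) with HasPSymbol σ J, F K σ := by
    rw [Finset.sum_filter, Finset.sum_map]
    rfl
  have hmem : ∀ σ : Permutation, σ ∈ (Finset.univ.map
      ⟨Sigma.mk (β := fun n => Equiv.Perm (Fin n)) J.left.numNodes, sigma_mk_injective⟩ :
        Finset Permutation) ↔ σ.1 = J.left.numNodes := by
    rintro ⟨n, s⟩
    rw [Finset.mem_map]
    constructor
    · rintro ⟨t, _, h⟩
      exact (congrArg Sigma.fst h).symm
    · rintro rfl
      exact ⟨s, Finset.mem_univ _, rfl⟩
  rw [hP, classSum]
  refine Finset.sum_bij (fun w _ => std w) ?_ ?_ ?_ (fun _ _ => rfl)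
  · intro w hw
    obtain ⟨hw, hT⟩ := Finset.mem_filter.1 hw
    refine Finset.mem_filter.2 ⟨(hmem _).2 ((perm_of_mem_wordsOn hw h₀).length_eq.trans hn), ?_⟩
    rw [HasPSymbol, (hsymb w hw).1, (hsymb w hw).2, hT]
    exact ⟨hl, hr⟩
  · intro w hw w' hw' h
    have hw := (Finset.mem_filter.1 hw).1
    have hw' := (Finset.mem_filter.1 hw').1
    rw [← hgw w hw, ← hgw w' hw', ← hword w hw, ← hword w' hw', h]
  · intro σ hσ
    obtain ⟨hσ, hJ⟩ := Finset.mem_filter.1 hσ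
    rw [hmem] at hσ
    have hp : (word σ).Perm (w₀.map f) := by
      rw [← hfw]
      refine perm_of_mem_wordsOn (word_mem_wordsOn σ) ?_
      rw [hσ, ← hn]
      exact word_mem_wordsOn (std w₀)
    have hw : (word σ).map g ∈ wordsOn B := by
      refine mem_wordsOn_of_perm h₀ ((hp.map g).trans ?_)
      rw [hgw w₀ h₀]
    have hstd : std ((word σ).map g) = σ := by
      rw [← std_map _ f (hmono _ hw), List.map_map]
      have : (word σ).map (f ∘ g) = word σ := by
        conv_rhs => rw [← List.map_id (word σ)]
        refine List.map_congr_left fun y hy => ?_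
        obtain ⟨x, hx, rfl⟩ := List.mem_map.1 (hp.subset hy)
        simp [hg x hx]
      rw [this, std_word]
    refine ⟨_, Finset.mem_filter.2 ⟨hw, ?_⟩, hstd⟩
    have := hsymb _ hw
    rw [hstd, hJ.1, hJ.2] at this
    rw [pSymbol_eq_iff_shape_eq (mem_wordsOn.1 hw).1 (perm_of_mem_wordsOn hw h₀), ← this.1,
      ← this.2, hl, hr]
    exact ⟨rfl, rfl⟩

theorem classSum_mem_Baxter [CommRing K] (B : Finset ℕ) (T : BinaryTree ℕ × BinaryTree ℕ) :
    classSum K B T ∈ Baxter K := by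
  by_cases h : ∃ w ∈ wordsOn B, pSymbol w = T
  · obtain ⟨w, hw, rfl⟩ := h
    obtain ⟨J, hl, hr⟩ := exists_twinBinaryTrees (mem_wordsOn.1 hw).1
    rw [classSum_eq_P K hw hl hr]
    exact Submodule.subset_span ⟨J, rfl⟩
  · rw [classSum, Finset.filter_eq_empty_iff.2 fun w hw hT => h ⟨w, hw, hT⟩, Finset.sum_empty]
    exact zero_mem _

/-- `P_J` is a class sum on any interval of letters of the right length, unless no permutation has
`P`-symbol `J`. -/
theorem P_eq_zero_or_classSum [CommRing K] (J : TwinBinaryTrees) (m : ℕ) :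
    P K J = 0 ∨
      ∃ T, P K J = classSum K ((Finset.Icc 1 J.left.numNodes).map (addRightEmbedding m)) T := by
  by_cases h : ∃ s, HasPSymbol ⟨J.left.numNodes, s⟩ J
  · right
    obtain ⟨s, hs⟩ := h
    have hmono : StrictMonoOn (· + m) {x | x ∈ word ⟨J.left.numNodes, s⟩} :=
      fun x _ y _ hxy => by simpa using hxy
    refine ⟨pSymbol ((word ⟨J.left.numNodes, s⟩).map (· + m)), (classSum_eq_P K ?_ ?_ ?_).symm⟩
    · rw [mem_wordsOn]
      refine ⟨shift_nodup _ m, ?_⟩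
      rw [← (mem_wordsOn.1 (word_mem_wordsOn ⟨J.left.numNodes, s⟩)).2]
      ext x
      simp
    · rw [pSymbol_map (word_nodup _) hmono, shape_map, hs.1]
    · rw [pSymbol_map (word_nodup _) hmono, shape_map, hs.2]
  · left
    rw [P]
    exact Finset.sum_eq_zero fun s _ => if_neg fun hs => h ⟨s, hs⟩

/-! ### The operations of `FQSym` on class sums -/

section Operations

variable [CommRing K]

/-- A sum over the words on `B` with coefficients depending only on the `P`-symbol is a combination
of class sums. -/
theorem sum_mem_of_pSymbol_congr {M X : Type*} [AddCommGroup M] [Module K M] [AddCommGroup X]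
    [Module K X] (φ : FQSym K →ₗ[K] M →ₗ[K] X) (N : Submodule K X) {B : Finset ℕ}
    {y : List ℕ → M}
    (hy : ∀ u ∈ wordsOn B, ∀ v ∈ wordsOn B, pSymbol u = pSymbol v → y u = y v)
    (h : ∀ u ∈ wordsOn B, φ (classSum K B (pSymbol u)) (y u) ∈ N) :
    ∑ u ∈ wordsOn B, φ (Fw K u) (y u) ∈ N := by
  rw [← Finset.sum_fiberwise_of_maps_to (g := pSymbol) (t := (wordsOn B).image pSymbol)
    fun u hu => Finset.mem_image_of_mem _ hu]
  refine sum_mem fun T hT => ?_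
  obtain ⟨u, hu, rfl⟩ := Finset.mem_image.1 hT
  have := h u hu
  rw [classSum, map_sum, LinearMap.sum_apply] at this
  rw [Finset.sum_congr rfl fun v hv => ?_]
  · exact this
  · rw [hy v (Finset.mem_filter.1 hv).1 u hu (Finset.mem_filter.1 hv).2]

theorem sum_Fw_mem_Baxter {B : Finset ℕ} (q : List ℕ → Prop) [DecidablePred q]
    (hq : ∀ u ∈ wordsOn B, ∀ v ∈ wordsOn B, pSymbol u = pSymbol v → (q u ↔ q v)) :
    ∑ u ∈ wordsOn B, (if q u then Fw K u else 0) ∈ Baxter K := by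
  have := sum_mem_of_pSymbol_congr K (LinearMap.lsmul K (FQSym K)).flip (Baxter K)
    (y := fun u => if q u then 1 else 0) (B := B)
    (fun u hu v hv huv => by simp only [hq u hu v hv huv])
    (fun u _ => Submodule.smul_mem _ _ (classSum_mem_Baxter K B _))
  simpa using this

/-- Cutting the words of a class after `i` letters gives a combination of products of classes,
because the `P`-symbols of two words determine that of their concatenation. -/
theorem sum_cut_mem {X : Type*} [AddCommGroup X] [Module K X]
    (φ : FQSym K →ₗ[K] FQSym K →ₗ[K] X) (N : Submodule K X) {B : Finset ℕ}
    (T : BinaryTree ℕ × BinaryTree ℕ) {i : ℕ} (hi : i ≤ B.card)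
    (h : ∀ C : Finset ℕ, C.card = i → ∀ S, ∀ y ∈ Baxter K, φ (classSum K C S) y ∈ N) :
    ∑ w ∈ wordsOn B with pSymbol w = T, φ (Fw K (w.take i)) (Fw K (w.drop i)) ∈ N := by
  have e : ∑ w ∈ wordsOn B with pSymbol w = T, φ (Fw K (w.take i)) (Fw K (w.drop i)) =
      ∑ w ∈ wordsOn B, (fun u v => if pSymbol (u ++ v) = T then φ (Fw K u) (Fw K v) else 0)
        (w.take i) (w.drop i) := by
    rw [Finset.sum_filter]
    simp only [List.take_append_drop]
  rw [e, sum_wordsOn_cut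
    (fun u v => if pSymbol (u ++ v) = T then φ (Fw K u) (Fw K v) else 0) B hi]
  refine sum_mem fun C hC => ?_
  have hnd : ∀ u ∈ wordsOn C, ∀ v ∈ wordsOn (B \ C), (u ++ v).Nodup := fun u hu v hv =>
    (mem_wordsOn.1 (append_mem_wordsOn Finset.disjoint_sdiff hu hv)).1
  have key := sum_mem_of_pSymbol_congr K φ N (B := C)
    (y := fun u => ∑ v ∈ wordsOn (B \ C), if pSymbol (u ++ v) = T then Fw K v else 0)
    (fun u hu u' hu' huu => Finset.sum_congr rfl fun v hv => by
      rw [pSymbol_append_congr (hnd u hu v hv) (hnd u' hu' v hv) huu rfl])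
    (fun u hu => h C (Finset.mem_powersetCard.1 hC).2 _ _
      (sum_Fw_mem_Baxter K (fun v => pSymbol (u ++ v) = T) fun v hv v' hv' hvv => by
        rw [pSymbol_append_congr (hnd u hu v hv) (hnd u hu v' hv') rfl hvv]))
  simpa only [map_sum, apply_ite, map_zero] using key

/-- The product of two classes on consecutive intervals of letters is a union of classes, because
the `P`-symbol of a word determines those of its restrictions. -/
theorem classSum_mul_mem {B C : Finset ℕ} {b : ℕ} (hB : ∀ x ∈ B, x ≤ b) (hC : ∀ x ∈ C, ¬x ≤ b)
    (S T : BinaryTree ℕ × BinaryTree ℕ) : classSum K B S * classSum K C T ∈ Baxter K := by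
  have e : classSum K B S * classSum K C T = ∑ u ∈ wordsOn B, ∑ v ∈ wordsOn C,
      shuffleSum (fun w => if pSymbol u = S ∧ pSymbol v = T then Fw K w else 0) u v := by
    rw [classSum, classSum, Finset.sum_mul_sum, Finset.sum_filter]
    refine Finset.sum_congr rfl fun u hu => ?_
    rw [Finset.sum_filter]
    split_ifs with hS
    · refine Finset.sum_congr rfl fun v hv => ?_
      rw [Fw_mul K (mem_wordsOn.1 hu).1 (mem_wordsOn.1 hv).1]
      · by_cases hT : pSymbol v = T <;> simp [hS, hT, shuffleSum]
      · intro x hx y hy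
        have := hB x ((mem_wordsOn.1 hu).2 ▸ List.mem_toFinset.2 hx)
        have := hC y ((mem_wordsOn.1 hv).2 ▸ List.mem_toFinset.2 hy)
        omega
    · simp [hS, shuffleSum]
  rw [e, sum_wordsOn_shuffle (fun u v w => if pSymbol u = S ∧ pSymbol v = T then Fw K w else 0)
    hB hC]
  refine sum_Fw_mem_Baxter K
    (fun w => pSymbol (w.filter (· ≤ b)) = S ∧ pSymbol (w.filter (¬ · ≤ b)) = T) ?_
  intro u hu v hv huv
  have hu := (mem_wordsOn.1 hu).1
  have hv := (mem_wordsOn.1 hv).1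
  rw [pSymbol_filter_le_congr hu hv huv, pSymbol_filter_not_le_congr hu hv huv]

theorem one_mem_Baxter : (1 : FQSym K) ∈ Baxter K := by
  have : classSum K ∅ (pSymbol []) = 1 := by
    rw [classSum, one_eq, show wordsOn ∅ = {[]} by ext w; simp +contextual [mem_wordsOn],
      Finset.filter_singleton, if_pos rfl, Finset.sum_singleton]
  exact this ▸ classSum_mem_Baxter K _ _

theorem mul_mem_Baxter {x y : FQSym K} (hx : x ∈ Baxter K) (hy : y ∈ Baxter K) :
    x * y ∈ Baxter K := by
  have h : Baxter K * Baxter K ≤ Baxter K := by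
    conv_lhs => rw [Baxter, Submodule.span_mul_span]
    rw [Submodule.span_le]
    rintro _ ⟨_, ⟨I, rfl⟩, _, ⟨J, rfl⟩, rfl⟩
    rcases P_eq_zero_or_classSum K I 0 with hI | ⟨S, hS⟩
    · simp [hI]
    rcases P_eq_zero_or_classSum K J I.left.numNodes with hJ | ⟨T, hT⟩
    · simp [hJ]
    change P K I * P K J ∈ Baxter K
    rw [hS, hT]
    refine classSum_mul_mem K (b := I.left.numNodes) ?_ ?_ S T
    · simp
    · simp
      omega
  exact h (Submodule.mul_mem_mul hx hy)

theorem comul_mem_Baxter {x : FQSym K} (hx : x ∈ Baxter K) :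
    Coalgebra.comul (R := K) x ∈
      LinearMap.range (TensorProduct.mapIncl (Baxter K) (Baxter K)) := by
  have h : Baxter K ≤ (LinearMap.range (TensorProduct.mapIncl (Baxter K) (Baxter K))).comap
      (Coalgebra.comul (R := K)) := by
    conv_lhs => rw [Baxter]
    rw [Submodule.span_le]
    rintro _ ⟨J, rfl⟩
    rw [SetLike.mem_coe, Submodule.mem_comap]
    rcases P_eq_zero_or_classSum K J 0 with hJ | ⟨T, hT⟩
    · rw [hJ, map_zero]
      exact zero_mem _
    rw [hT]
    generalize (Finset.Icc 1 J.left.numNodes).map (addRightEmbedding 0) = B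
    have e : Coalgebra.comul (R := K) (classSum K B T) = ∑ i ∈ Finset.range (B.card + 1),
        ∑ w ∈ wordsOn B with pSymbol w = T,
          TensorProduct.mk K (FQSym K) (FQSym K) (Fw K (w.take i)) (Fw K (w.drop i)) := by
      rw [classSum, map_sum, Finset.sum_comm]
      refine Finset.sum_congr rfl fun w hw => ?_
      have hw := (Finset.mem_filter.1 hw).1
      rw [comul_Fw K (mem_wordsOn.1 hw).1, cutSum, length_of_mem_wordsOn hw]
      rfl
    rw [e]
    refine sum_mem fun i hi => ?_
    refine sum_cut_mem K _ _ T (Nat.lt_succ_iff.1 (Finset.mem_range.1 hi)) fun C _ S y hy => ?_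
    exact ⟨⟨_, classSum_mem_Baxter K C S⟩ ⊗ₜ ⟨y, hy⟩, rfl⟩
  exact h hx

/-- The recursion for the antipode only involves classes of smaller words. -/
theorem antipode_classSum_mem (B : Finset ℕ) (T : BinaryTree ℕ × BinaryTree ℕ) :
    antipodeMap K (classSum K B T) ∈ Baxter K := by
  induction h : B.card using Nat.strong_induction_on generalizing B T with
  | _ n ih =>
    subst h
    rcases B.eq_empty_or_nonempty with rfl | hB
    · rw [classSum, map_sum]
      refine sum_mem fun w hw => ?_
      have hw : w = [] := by
        simpa using length_of_mem_wordsOn (Finset.mem_filter.1 hw).1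
      rw [hw, antipodeMap_Fw K List.nodup_nil, antipodeWord, if_pos rfl]
      exact one_mem_Baxter K
    · have e : antipodeMap K (classSum K B T) = -∑ i ∈ Finset.range B.card,
          ∑ w ∈ wordsOn B with pSymbol w = T,
            (LinearMap.mul K (FQSym K) ∘ₗ antipodeMap K) (Fw K (w.take i)) (Fw K (w.drop i)) := by
        rw [classSum, map_sum, Finset.sum_comm, ← Finset.sum_neg_distrib]
        refine Finset.sum_congr rfl fun w hw => ?_
        have hw := (Finset.mem_filter.1 hw).1
        have hl := length_of_mem_wordsOn hw
        have hw := (mem_wordsOn.1 hw).1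
        rw [antipodeMap_Fw K hw, antipodeWord, if_neg, ← hl, neg_inj,
          ← Fin.sum_univ_eq_sum_range (fun i => (LinearMap.mul K (FQSym K) ∘ₗ antipodeMap K)
            (Fw K (w.take i)) (Fw K (w.drop i)))]
        · refine Finset.sum_congr rfl fun i _ => ?_
          rw [LinearMap.comp_apply, antipodeMap_Fw K (hw.sublist (List.take_sublist _ _))]
          rfl
        · rintro rfl
          exact hB.card_ne_zero hl.symm
      rw [e]
      refine neg_mem (sum_mem fun i hi => ?_)
      rw [Finset.mem_range] at hi
      refine sum_cut_mem K _ _ T hi.le fun C hC S y hy => ?_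
      exact mul_mem_Baxter K (ih _ hi C S hC) hy

theorem antipode_mem_Baxter {x : FQSym K} (hx : x ∈ Baxter K) :
    HopfAlgebra.antipode K x ∈ Baxter K := by
  have h : Baxter K ≤ (Baxter K).comap (antipodeMap K) := by
    conv_lhs => rw [Baxter]
    rw [Submodule.span_le]
    rintro _ ⟨J, rfl⟩
    rw [SetLike.mem_coe, Submodule.mem_comap]
    rcases P_eq_zero_or_classSum K J 0 with hJ | ⟨T, hT⟩
    · rw [hJ, map_zero]
      exact zero_mem _
    · rw [hT]
      exact antipode_classSum_mem K _ T
  exact h hx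

end Operations

end BaxterHopf

theorem mainTheorem1 (K : Type*) [Field K] [CharZero K] :
    BaxterHopf.IsHopfSubalgebra K (BaxterHopf.Baxter K) where
  one_mem := BaxterHopf.one_mem_Baxter K
  mul_mem _ hx _ hy := BaxterHopf.mul_mem_Baxter K hx hy
  comul_mem _ hx := BaxterHopf.comul_mem_Baxter K hx
  antipode_mem _ hx := BaxterHopf.antipode_mem_Baxter K hx
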